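/- A graph means a simplicial graph, with the path metric in which every edge is isometric to $[0,1]$. A cycle of length $n\ge 1$ in a graph $\Gamma$ is a combinatorial map $f\colon C\to\Gamma$, not collapsing edges and not necessarily injective, from a circle $C$ subdivided into $n$ edges of length $1$. It is isometric if it is an isometric embedding, and, for $\xi\in(0,1)$, it is $\xi$-almost isometric if $d_\Gamma(f(p),f(q))\ge \xi\frac n2$ for every pair of antipodal points $p,q\in C$ (vertices or interior points of edges). A connected graph $\Gamma$ is shortcut if, for some $\theta\in\mathbb N$, all its isometric cycles have length at most $\theta$; it is strongly shortcut if, for some $\theta\in\mathbb N$ and some $\xi\in(0,1)$, all its $\xi$-almost isometric cycles have length at most $\theta$. A group is (strongly) shortcut if it acts properly and cocompactly by graph automorphisms on a (strongly) shortcut graph, i.e. with finite cell stabilizers and finitely many orbits of vertices and edges. Let $\mathscr G$ be a graph of groups over a finite connected graph (loops and multiple edges allowed), with injective edge homomorphisms and finite edge groups. Let $T$ be any spanning tree of the underlying graph, and let $\pi_1(\mathscr G,T)$ be the fundamental group: the quotient of the free product of the vertex groups and of the free group on the (oriented) edges $e$ by the relations $e\,s_e(h)\,e^{-1}=t_e(h)$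 for $h$ in the edge group of $e$, where $s_e,t_e$ are the edge homomorphisms into the vertex groups at the origin and the end of $e$, and $e=1$ for $e\in T$. 1. If every vertex group of $\mathscr G$ is shortcut, then $\pi_1(\mathscr G,T)$ is shortcut. If every vertex group of $\mathscr G$ is strongly shortcut, then $\pi_1(\mathscr G,T)$ is strongly shortcut. 2. In particular, if $G_0,G_1$ are shortcut (respectively strongly shortcut) groups and $C$ is a finite group with injective homomorphisms $C\to G_0$ and $C\to G_1$, then the amalgamated product $G_0*_C G_1$ is shortcut (respectively strongly shortcut). If $G$ is a shortcut (respectively strongly shortcut) group and $\varphi\colon A\to B$ is an isomorphism between finite subgroups of $G$, then the HNN extension $\langle G,t\mid tat^{-1}=\varphi(a),\ a\in A\rangle$ is shortcut (respectively strongly shortcut). -/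

import Mathlib

universe u v w x

/-! ### Shortcut graphs

A simplicial graph is a `SimpleGraph`; its geometric realization is the metric graph whose edges are
isometric to `[0, 1]`. -/

namespace ShortcutGraph

/-- A point of the geometric realization of `Γ` lying on a closed edge, given in coordinates: an
oriented edge `dart` together with the distance `offset` of the point from the origin of that
oriented edge.  (A point has several coordinates, which are at distance `0` for `pointDist`.) -/
structure EdgePoint {V : Type u} (Γ : SimpleGraph V) where
  dart : Γ.Dart
  offset : ℝ
  offset_nonneg : 0 ≤ offset
  offset_le_one : offset ≤ 1

/-- The distance in the geometric realization of a connected graph `Γ` from a point on an edge to a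
vertex: a geodesic leaves the edge through one of its two endpoints. -/
noncomputable def distToVertex {V : Type u} {Γ : SimpleGraph V} (p : EdgePoint Γ) (v : V) : ℝ :=
  min (p.offset + (Γ.dist p.dart.fst v : ℝ)) ((1 - p.offset) + (Γ.dist p.dart.snd v : ℝ))

open Classical in
/-- The distance in the geometric realization of a connected graph `Γ` between two points lying on
edges: a shortest path either enters the edge of `q` through one of its two endpoints or, when both
points lie on the same edge, it may be the segment of that edge between them. -/
noncomputable def pointDist {V : Type u} {Γ : SimpleGraph V} (p q : EdgePoint Γ) : ℝ :=
  let viaEnds : ℝ :=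
    min (distToVertex p q.dart.fst + q.offset) (distToVertex p q.dart.snd + (1 - q.offset))
  if p.dart = q.dart then min viaEnds |p.offset - q.offset|
  else if p.dart = q.dart.symm then min viaEnds |p.offset - (1 - q.offset)|
  else viaEnds

/-- A cycle of length `n` in `Γ`: a nondegenerate combinatorial map to `Γ` from the circle with `n`
vertices (indexed by `ZMod n`) and `n` edges (the `i`-th one joins `i` to `i + 1`). It need not be
injective. -/
structure Cycle {V : Type u} (Γ : SimpleGraph V) (n : ℕ) where
  vertex : ZMod n → V
  adj : ∀ i, Γ.Adj (vertex i) (vertex (i + 1))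

/-- The map of a cycle on the geometric realization `ℝ / nℤ` of its domain: the point `t` is at
distance `Int.fract t` from the origin of the edge of index `⌊t⌋`. -/
noncomputable def Cycle.point {V : Type u} {Γ : SimpleGraph V} {n : ℕ} (f : Cycle Γ n) (t : ℝ) :
    EdgePoint Γ where
  dart := ⟨(f.vertex ((⌊t⌋ : ℤ) : ZMod n), f.vertex (((⌊t⌋ : ℤ) : ZMod n) + 1)), f.adj _⟩
  offset := Int.fract t
  offset_nonneg := Int.fract_nonneg t
  offset_le_one := (Int.fract_lt_one t).le

/-- The cycle is an isometric embedding of the circle `ℝ / nℤ` of length `n`. -/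
def Cycle.IsIsometric {V : Type u} {Γ : SimpleGraph V} {n : ℕ} (f : Cycle Γ n) : Prop :=
  ∀ s t : ℝ, pointDist (f.point s) (f.point t) = dist (s : AddCircle (n : ℝ)) (t : AddCircle (n : ℝ))

/-- Antipodal points of the cycle are sent to points at distance at least `ξ n / 2`. -/
def Cycle.IsAlmostIsometric {V : Type u} {Γ : SimpleGraph V} {n : ℕ} (f : Cycle Γ n) (ξ : ℝ) :
    Prop :=
  ∀ t : ℝ, ξ * ((n : ℝ) / 2) ≤ pointDist (f.point t) (f.point (t + (n : ℝ) / 2))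

/-- A shortcut graph. -/
def IsShortcutGraph {V : Type u} (Γ : SimpleGraph V) : Prop :=
  Γ.Connected ∧ ∃ θ : ℕ, ∀ n : ℕ, 0 < n → ∀ f : Cycle Γ n, f.IsIsometric → n ≤ θ

/-- A strongly shortcut graph. -/
def IsStronglyShortcutGraph {V : Type u} (Γ : SimpleGraph V) : Prop :=
  Γ.Connected ∧ ∃ θ : ℕ, ∃ ξ : ℝ, 0 < ξ ∧ ξ < 1 ∧
    ∀ n : ℕ, 0 < n → ∀ f : Cycle Γ n, f.IsAlmostIsometric ξ → n ≤ θ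

/-- `G` acts on the graph `Γ` by graph automorphisms, properly (cell stabilizers are finite) and
cocompactly (there are finitely many orbits of vertices and of edges).  Finiteness of the vertex
stabilizers implies that of the edge stabilizers. -/
structure IsProperCocompactAction (G : Type u) [Group G] {V : Type v} [MulAction G V]
    (Γ : SimpleGraph V) : Prop where
  adj_smul : ∀ (g : G) (a b : V), Γ.Adj a b → Γ.Adj (g • a) (g • b)
  finite_stabilizer : ∀ a : V, Finite (MulAction.stabilizer G a)
  finite_vertex_orbits : Finite (MulAction.orbitRel.Quotient G V)
  finite_edge_orbits : ∃ S : Set (V × V), S.Finite ∧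
    ∀ a b : V, Γ.Adj a b → ∃ g : G, (g • a, g • b) ∈ S

/-- A shortcut group: it acts properly and cocompactly on a shortcut graph.  (The vertex set of such
a graph is a finite union of quotients of `G`, so nothing is lost by taking it in the universe of
`G`.) -/
def IsShortcutGroup (G : Type u) [Group G] : Prop :=
  ∃ (V : Type u) (Γ : SimpleGraph V) (_ : MulAction G V),
    IsShortcutGraph Γ ∧ IsProperCocompactAction G Γ

/-- A strongly shortcut group: it acts properly and cocompactly on a strongly shortcut graph. -/
def IsStronglyShortcutGroup (G : Type u) [Group G] : Prop :=
  ∃ (V : Type u) (Γ : SimpleGraph V) (_ : MulAction G V),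
    IsStronglyShortcutGraph Γ ∧ IsProperCocompactAction G Γ

end ShortcutGraph

/-! ### Graphs of groups -/

/-- A graph of groups with vertex set `V` and edge set `E`, each edge being given an orientation
(loops and multiple edges are allowed): groups at the vertices and at the edges, and an injective
homomorphism from each edge group to the vertex group at each of the two ends of the edge. -/
structure GraphOfGroups (V : Type u) (E : Type v) where
  src : E → V
  tgt : E → V
  vertexGroup : V → Type w
  edgeGroup : E → Type x
  [vertexGroupInst : ∀ a, Group (vertexGroup a)]
  [edgeGroupInst : ∀ e, Group (edgeGroup e)]
  srcHom : ∀ e, edgeGroup e →* vertexGroup (src e)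
  tgtHom : ∀ e, edgeGroup e →* vertexGroup (tgt e)
  srcHom_injective : ∀ e, Function.Injective (srcHom e)
  tgtHom_injective : ∀ e, Function.Injective (tgtHom e)

namespace GraphOfGroups

attribute [instance] vertexGroupInst edgeGroupInst

/-- The set `T` of edges, together with all the vertices, is a spanning tree of the underlying
graph: it has no loops and no multiple edges, and the simple graph that it spans is a tree. (In
particular the underlying graph is nonempty and connected.) -/
def IsSpanningTree {V : Type u} {E : Type v} (𝒢 : GraphOfGroups.{u, v, w, x} V E) (T : Set E) :
    Prop :=
  (∀ e ∈ T, 𝒢.src e ≠ 𝒢.tgt e) ∧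
  Set.InjOn (fun e => s(𝒢.src e, 𝒢.tgt e)) T ∧
  (SimpleGraph.fromRel fun a b => ∃ e ∈ T, 𝒢.src e = a ∧ 𝒢.tgt e = b).IsTree

/-- The free product of all the vertex groups and of the free group on the edges. -/
abbrev PreGroup {V : Type u} {E : Type v} (𝒢 : GraphOfGroups.{u, v, w, x} V E) : Type (max u v w) :=
  Monoid.Coprod (Monoid.CoprodI 𝒢.vertexGroup) (FreeGroup E)

/-- The inclusion of a vertex group in the free product. -/
def ofVertex {V : Type u} {E : Type v} (𝒢 : GraphOfGroups.{u, v, w, x} V E) (a : V) :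
    𝒢.vertexGroup a →* 𝒢.PreGroup :=
  Monoid.Coprod.inl.comp Monoid.CoprodI.of

/-- The stable letter of an edge in the free product. -/
def stableLetter {V : Type u} {E : Type v} (𝒢 : GraphOfGroups.{u, v, w, x} V E) (e : E) :
    𝒢.PreGroup :=
  Monoid.Coprod.inr (FreeGroup.of e)

/-- The relators of the fundamental group with respect to `T`: those of the relations
`e · srcHom e h · e⁻¹ = tgtHom e h` for every edge `e`, and `e = 1` for `e ∈ T`. -/
def relators {V : Type u} {E : Type v} (𝒢 : GraphOfGroups.{u, v, w, x} V E) (T : Set E) :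
    Set 𝒢.PreGroup :=
  {r | ∃ (e : E) (h : 𝒢.edgeGroup e),
      r = 𝒢.stableLetter e * 𝒢.ofVertex (𝒢.src e) (𝒢.srcHom e h) * (𝒢.stableLetter e)⁻¹ *
        (𝒢.ofVertex (𝒢.tgt e) (𝒢.tgtHom e h))⁻¹} ∪
  {r | ∃ e ∈ T, r = 𝒢.stableLetter e}

/-- The fundamental group of a graph of groups with respect to a spanning tree `T`. -/
abbrev FundamentalGroup {V : Type u} {E : Type v} (𝒢 : GraphOfGroups.{u, v, w, x} V E)
    (T : Set E) : Type (max u v w) :=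
  𝒢.PreGroup ⧸ Subgroup.normalClosure (𝒢.relators T)

end GraphOfGroups

-- The fundamental group `G` acts on its Bass–Serre tree with finite edge stabilizers. Choose graphs
-- on which the vertex groups act, and blow the tree up to a tree of spaces: a tree vertex becomes a
-- translate of such a graph (a piece), and a tree edge, i.e. a coset of an edge group, becomes a
-- star whose legs end at translates of base points on both sides. The action of `G` on the result
-- is proper and cocompact (`isProperCocompactAction_treeOfSpaces`). It remains to control its long
-- (almost) isometric cycles by those of the pieces.
--
-- The centers of the stars are cut vertices. An edge group need not fix base points, so a star may
-- have several feet in one piece. By finiteness their distances are bounded by some `K`, and since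
-- the legs are longer than `K`, every piece is a 1-Lipschitz retract of the whole graph, the
-- retraction moving nothing far relative to the cut vertices. `StarDecomposition` abstracts this
-- situation, with a bound `B`.
--
-- Let a closed walk be quasi-isometric up to an additive error `δ`. A vertex minimizing the sum of
-- the distances to the walk has at most half of the walk beyond any other cut vertex, which yields
-- a central piece (`exists_central_piece`). An excursion of the walk beyond a cut vertex starts and
-- ends at that vertex and is at most half of the walk, so its length is at most `δ`
-- (`dist_pt_le_of_beyond`). Hence the retraction onto the central piece moves the walk by at most
-- `δ + 2 * B`, and produces a walk in the piece with error `3 * δ + 4 * B`. If the walk is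
-- isometric and long, it already lies in the piece.
--
-- Retraction creates stationary steps. The strong shortcut property is therefore rephrased for lazy
-- closed walks (`NoQuasiIsometricCycles`): the additive error of a long lazy cycle is at least
-- linear in its length. Stationary steps are removed by a parity argument
-- (`exists_cycle_of_even_waits`).
--
-- Bass–Serre theory enters only through `Splitting`, without normal forms. Vertex groups embed in
-- `G` because free actions of a finite group on an infinite group by translations are conjugate
-- (`incl_injective`). Edges separate because `G` acts affinely on the functions from the edges to
-- `ZMod 2`, with an orbit map whose values at the two ends of an edge differ exactly at that edge
-- (`exists_side`). Amalgams and HNN extensions are the graphs of groups with one edge.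

universe y z

/-! ### Lazy cycles -/

namespace SimpleGraph

variable {V : Type*} {V' : Type*}

/-- A closed walk of length `N` that may stay at a vertex for some time. -/
def IsLazyCycle (Γ : SimpleGraph V) {N : ℕ} (F : ZMod N → V) : Prop :=
  ∀ z, F z = F (z + 1) ∨ Γ.Adj (F z) (F (z + 1))

/-- A closed walk of length `N` is a quasi-isometric embedding up to the additive error `δ`. -/
def IsQuasiIsometric (Γ : SimpleGraph V) {N : ℕ} (F : ZMod N → V) (δ : ℕ) : Prop :=
  ∀ (z : ZMod N) (k : ℕ), 2 * k ≤ N → k ≤ Γ.dist (F z) (F (z + k)) + δ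

/-- Long lazy cycles have an additive error that is linear in their length. -/
def NoQuasiIsometricCycles (Γ : SimpleGraph V) (c : ℕ) : Prop :=
  ∀ (N δ : ℕ) (F : ZMod N → V), c < N → c * δ ≤ N → Γ.IsLazyCycle F → ¬ Γ.IsQuasiIsometric F δ

theorem NoQuasiIsometricCycles.mono {Γ : SimpleGraph V} {c c' : ℕ}
    (h : Γ.NoQuasiIsometricCycles c) (hc : c ≤ c') : Γ.NoQuasiIsometricCycles c' :=
  fun N δ F hN hδ => h N δ F (hc.trans_lt hN) ((Nat.mul_le_mul_right δ hc).trans hδ)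

theorem dist_le_one_of_eq_or_adj {Γ : SimpleGraph V} {a b : V} (h : a = b ∨ Γ.Adj a b) :
    Γ.dist a b ≤ 1 := by
  rcases h with rfl | h
  · simp
  · exact (dist_eq_one_iff_adj.2 h).le

theorem IsLazyCycle.dist_le {Γ : SimpleGraph V} (hΓ : Γ.Connected) {N : ℕ} {F : ZMod N → V}
    (hF : Γ.IsLazyCycle F) (z : ZMod N) (k : ℕ) : Γ.dist (F z) (F (z + k)) ≤ k := by
  induction k with
  | zero => simp
  | succ k ih =>
    have h1 := dist_le_one_of_eq_or_adj (hF (z + k))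
    have h2 := hΓ.dist_triangle (u := F z) (v := F (z + k)) (w := F (z + k + 1))
    push_cast
    rw [← add_assoc]
    omega

theorem dist_le_of_lazy_map {Γ : SimpleGraph V} {Γ' : SimpleGraph V'} (hΓ : Γ.Connected)
    (hΓ' : Γ'.Connected) (r : V → V')
    (hr : ∀ a b, Γ.Adj a b → r a = r b ∨ Γ'.Adj (r a) (r b)) (a b : V) :
    Γ'.dist (r a) (r b) ≤ Γ.dist a b := by
  obtain ⟨p, hp⟩ := hΓ.exists_walk_length_eq_dist a b
  rw [← hp]
  clear hp
  induction p with
  | nil => simp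
  | cons h p ih =>
    have h1 := dist_le_one_of_eq_or_adj (hr _ _ h)
    have h2 := hΓ'.dist_triangle (u := r _) (v := r _) (w := r _) |>.trans (Nat.add_le_add h1 ih)
    simpa [add_comm] using h2

theorem Walk.mem_support_of_separates {Γ : SimpleGraph V} {α : Type*} (σ : V → α) (c : V)
    (hσ : ∀ a b, Γ.Adj a b → σ a ≠ σ b → a = c ∨ b = c) {a b : V} (p : Γ.Walk a b)
    (h : σ a ≠ σ b) : c ∈ p.support := by
  induction p with
  | nil => exact absurd rfl h
  | @cons u v w hadj p ih =>
    by_cases huv : σ u = σ v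
    · exact List.mem_cons_of_mem _ (ih (huv ▸ h))
    · rcases hσ _ _ hadj huv with rfl | rfl
      · simp
      · simp

/-- A geodesic between vertices with different values of `σ` has to visit `c`; cutting it there
gives the nontrivial inequality. -/
theorem dist_eq_add_of_separates {Γ : SimpleGraph V} (hΓ : Γ.Connected) {α : Type*} (σ : V → α)
    (c : V) (hσ : ∀ a b, Γ.Adj a b → σ a ≠ σ b → a = c ∨ b = c) {a b : V} (h : σ a ≠ σ b) :
    Γ.dist a b = Γ.dist a c + Γ.dist c b := by
  classical
  refine le_antisymm hΓ.dist_triangle ?_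
  obtain ⟨p, hp⟩ := hΓ.exists_walk_length_eq_dist a b
  have hc := p.mem_support_of_separates σ c hσ h
  rw [← hp, ← p.take_spec hc, Walk.length_append]
  exact add_le_add (dist_le _) (dist_le _)

/-! ### Graphs decomposed along cut vertices -/

/-- A decomposition of the graph `X` into pieces `Γ i` glued along cut vertices `pt s`. The
function `side s` is constant off `pt s` on the components of the complement of `pt s`; `retr i`
retracts `X` onto the piece of index `i`, mapping the part `branch i s` of the complement of this
piece hanging behind `pt s` at bounded distance from `pt s`. -/
structure StarDecomposition {W : Type*} (X : SimpleGraph W) {I : Type*} {P : I → Type*}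
    (Γ : ∀ i, SimpleGraph (P i)) (S : Type*) (B : ℕ) where
  pt : S → W
  side : S → W → ZMod 2
  side_eq_or : ∀ s a b, X.Adj a b → side s a ≠ side s b → a = pt s ∨ b = pt s
  emb : ∀ i, P i → W
  emb_adj : ∀ i a b, (Γ i).Adj a b → X.Adj (emb i a) (emb i b)
  pieceSide : I → S → ZMod 2
  retr : ∀ i, W → P i
  retr_emb : ∀ i a, retr i (emb i a) = a
  retr_adj : ∀ i a b, X.Adj a b → retr i a = retr i b ∨ (Γ i).Adj (retr i a) (retr i b)
  retr_eq_of_adj : ∀ i a b, X.Adj (emb i a) b → b ∉ Set.range (emb i) → retr i b = a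
  branch : I → S → Set W
  exists_mem_branch : ∀ i a, a ∉ Set.range (emb i) → ∃ s, a ∈ branch i s
  mem_branch_of_adj : ∀ i s a b, a ∈ branch i s → X.Adj a b → b ∉ Set.range (emb i) →
    b ∈ branch i s
  dist_pt_le : ∀ i s a, a ∈ branch i s → a = pt s ∨ side s a = pieceSide i s → X.dist a (pt s) ≤ B
  dist_retr_le : ∀ i s a, a ∈ branch i s → X.dist (emb i (retr i a)) (pt s) ≤ B
  -- The median of a walk is an arbitrary vertex. This field turns it into a piece lying on the same
  -- side of all cut vertices, or into two pieces when the median is itself a cut vertex.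
  location : ∀ a, (∃ i, ∀ s, a ≠ pt s ∧ side s a = pieceSide i s) ∨
    ∃ s₀ i j, a = pt s₀ ∧ pieceSide i s₀ ≠ pieceSide j s₀ ∧
      ∀ s, s ≠ s₀ → a ≠ pt s ∧ side s a = pieceSide i s ∧ side s a = pieceSide j s

namespace StarDecomposition

variable {W : Type*} {X : SimpleGraph W} {I : Type*} {P : I → Type*}
  {Γ : ∀ i, SimpleGraph (P i)} {S : Type*} {B : ℕ}

/-- The vertices separated from the piece of index `i` by the cut vertex `pt s`. -/
def beyond (D : StarDecomposition X Γ S B) (i : I) (s : S) : Set W :=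
  {a | a ≠ D.pt s ∧ D.side s a ≠ D.pieceSide i s}

theorem emb_injective (D : StarDecomposition X Γ S B) (i : I) : Function.Injective (D.emb i) :=
  fun a b h => by rw [← D.retr_emb i a, h, D.retr_emb]

theorem dist_emb (D : StarDecomposition X Γ S B) (hX : X.Connected) (hΓ : ∀ i, (Γ i).Connected)
    (i : I) (a b : P i) : X.dist (D.emb i a) (D.emb i b) = (Γ i).dist a b := by
  refine le_antisymm (dist_le_of_lazy_map (hΓ i) hX _ (fun a b h => Or.inr (D.emb_adj i a b h)) a b)
    ?_
  have h := dist_le_of_lazy_map hX (hΓ i) _ (D.retr_adj i) (D.emb i a) (D.emb i b)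
  rwa [D.retr_emb, D.retr_emb] at h

theorem adj_emb_iff (D : StarDecomposition X Γ S B) (i : I) (a b : P i) :
    X.Adj (D.emb i a) (D.emb i b) ↔ (Γ i).Adj a b := by
  refine ⟨fun h => ?_, D.emb_adj i a b⟩
  rcases D.retr_adj i _ _ h with h' | h'
  · rw [D.retr_emb, D.retr_emb] at h'
    exact absurd (h' ▸ h) (X.irrefl)
  · rwa [D.retr_emb, D.retr_emb] at h'

theorem eq_pt_of_adj_beyond (D : StarDecomposition X Γ S B) {i : I} {s : S} {a b : W}
    (ha : a ∈ D.beyond i s) (hab : a = b ∨ X.Adj a b) (hb : b ∉ D.beyond i s) : b = D.pt s := by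
  rcases hab with rfl | hab
  · exact absurd ha hb
  by_contra hne
  have hs : D.side s b = D.pieceSide i s := by
    by_contra h
    exact hb ⟨hne, h⟩
  rcases D.side_eq_or s a b hab (by rw [hs]; exact ha.2) with h | h
  · exact ha.1 h
  · exact hne h

theorem exists_first_exit {α : Type*} (p : α → Prop) (g : ℕ → α) (h : ∃ k, ¬ p (g k)) (h0 : p (g 0)) :
    ∃ b, p (g b) ∧ ¬ p (g (b + 1)) ∧ ∀ k ≤ b, p (g k) := by
  classical
  have hspec := Nat.find_spec h
  have hmin := fun m => Nat.find_min (m := m) h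
  obtain ⟨b, hb⟩ : ∃ b, Nat.find h = b + 1 := by
    refine Nat.exists_eq_succ_of_ne_zero fun h1 => ?_
    rw [h1] at hspec
    exact hspec h0
  rw [hb] at hspec hmin
  exact ⟨b, not_not.1 (hmin b b.lt_succ_self), hspec, fun k hk =>
    not_not.1 (hmin k (Nat.lt_succ_of_le hk))⟩

/-! ### The central piece of a closed walk -/

section Median

variable {N : ℕ} [NeZero N]

open Classical in
-- Moving `x` to `pt s`, at distance `d`, brings the vertices of the walk on the other side closer
-- by exactly `d` and the remaining ones farther by at most `d`. Minimality forbids a majority on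
-- the other side.
theorem card_le_of_isMin (D : StarDecomposition X Γ S B) (hX : X.Connected) (F : ZMod N → W)
    (x : W) (hx : ∀ y, ∑ z, X.dist x (F z) ≤ ∑ z, X.dist y (F z)) (s : S) (hs : x ≠ D.pt s) :
    2 * (Finset.univ.filter fun z => F z ≠ D.pt s ∧ D.side s (F z) ≠ D.side s x).card ≤ N := by
  set A := Finset.univ.filter fun z => F z ≠ D.pt s ∧ D.side s (F z) ≠ D.side s x
  set d := X.dist x (D.pt s) with hd
  have hd0 : 0 < d := hX.pos_dist_of_ne hs
  have key : ∀ z, X.dist (D.pt s) (F z) + (if z ∈ A then d else 0) ≤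
      X.dist x (F z) + (if z ∈ A then 0 else d) := by
    intro z
    by_cases hz : z ∈ A
    · have h1 := (Finset.mem_filter.1 hz).2
      rw [if_pos hz, if_pos hz, dist_eq_add_of_separates hX (D.side s) (D.pt s)
        (D.side_eq_or s) (Ne.symm h1.2)]
      omega
    · rw [if_neg hz, if_neg hz]
      have := hX.dist_triangle (u := D.pt s) (v := x) (w := F z)
      rw [X.dist_comm (u := D.pt s) (v := x)] at this
      omega
  have hsum := Finset.sum_le_sum fun z (_ : z ∈ Finset.univ) => key z
  rw [Finset.sum_add_distrib, Finset.sum_add_distrib] at hsum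
  have h1 := hx (D.pt s)
  have h2 : ∑ z : ZMod N, (if z ∈ A then d else 0) = A.card * d := by
    rw [Finset.sum_ite_mem, Finset.univ_inter, Finset.sum_const, smul_eq_mul]
  have h3 : ∑ z : ZMod N, (if z ∈ A then 0 else d) + A.card * d = N * d := by
    rw [← h2, ← Finset.sum_add_distrib]
    have : ∀ z : ZMod N, ((if z ∈ A then 0 else d) + if z ∈ A then d else 0) = d := by
      intro z; split_ifs <;> simp
    simp [this, ZMod.card]
  have h4 : (2 * A.card) * d ≤ N * d := by nlinarith
  exact Nat.le_of_mul_le_mul_right h4 hd0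

open Classical in
/-- Some piece contains the majority of the cycle with respect to every cut vertex. -/
theorem exists_central_piece (D : StarDecomposition X Γ S B) (hX : X.Connected) (F : ZMod N → W) :
    ∃ i, ∀ s, 2 * (Finset.univ.filter fun z => F z ∈ D.beyond i s).card ≤ N := by
  have := hX.nonempty
  let x := Function.argmin (fun y => ∑ z, X.dist y (F z))
  have hx : ∀ y, ∑ z, X.dist x (F z) ≤ ∑ z, X.dist y (F z) := fun y =>
    Function.argmin_le (fun y => ∑ z, X.dist y (F z)) y
  have hcard := D.card_le_of_isMin hX F x hx
  rcases D.location x with ⟨i, hi⟩ | ⟨s₀, i, j, hx0, hij, hs⟩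
  · refine ⟨i, fun s => ?_⟩
    have := hcard s (hi s).1
    rw [(hi s).2] at this
    convert this
    rfl
  -- The median is a cut vertex between the pieces `i` and `j`. What lies beyond `s₀` for one is not
  -- beyond it for the other, so one of these two sets is at most half of the walk.
  · have hdisj : Disjoint (Finset.univ.filter fun z => F z ∈ D.beyond i s₀)
        (Finset.univ.filter fun z => F z ∈ D.beyond j s₀) := by
      rw [Finset.disjoint_filter]
      rintro z - ⟨-, h1⟩ ⟨-, h2⟩
      revert hij h1 h2
      generalize D.pieceSide i s₀ = a
      generalize D.pieceSide j s₀ = b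
      generalize D.side s₀ (F z) = c
      revert a b c
      decide
    have hle := Finset.card_le_univ (Finset.disjUnion _ _ hdisj)
    rw [Finset.card_disjUnion, ZMod.card] at hle
    have other : ∀ k, (∀ s, s ≠ s₀ → D.side s x = D.pieceSide k s) →
        2 * (Finset.univ.filter fun z => F z ∈ D.beyond k s₀).card ≤ N →
        ∃ i, ∀ s, 2 * (Finset.univ.filter fun z => F z ∈ D.beyond i s).card ≤ N := by
      intro k hk h0
      refine ⟨k, fun s => ?_⟩
      by_cases h : s = s₀
      · rwa [h]
      · have := hcard s (hs s h).1
        rw [hk s h] at this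
        convert this
        rfl
    by_cases hi : 2 * (Finset.univ.filter fun z => F z ∈ D.beyond i s₀).card ≤ N
    · exact other i (fun s h => (hs s h).2.1) hi
    · exact other j (fun s h => (hs s h).2.2) (by omega)

open Classical in
-- The maximal run of the walk around `z` beyond `s` is entered and left at `pt s`. It is at most
-- half of the walk, so its two ends, which coincide in `X`, bound its length by `δ`.
theorem dist_pt_le_of_beyond (D : StarDecomposition X Γ S B) (hX : X.Connected) {F : ZMod N → W}
    (hF : X.IsLazyCycle F) {δ : ℕ} (hδ : X.IsQuasiIsometric F δ) (hN : 2 * δ + 2 < N) {i : I} {s : S}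
    (hcard : 2 * (Finset.univ.filter fun z => F z ∈ D.beyond i s).card ≤ N) {z : ZMod N}
    (hz : F z ∈ D.beyond i s) : X.dist (F z) (D.pt s) ≤ δ := by
  obtain ⟨y, hy⟩ : ∃ y, F y ∉ D.beyond i s := by
    by_contra! h
    rw [Finset.filter_true_of_mem fun z _ => h z, Finset.card_univ, ZMod.card] at hcard
    omega
  obtain ⟨b, hb0, hb1, hb⟩ := exists_first_exit (fun z => F z ∈ D.beyond i s) (fun k => z + k)
    ⟨(y - z).val, by simpa using hy⟩ (by simpa using hz)
  obtain ⟨a, ha0, ha1, ha⟩ := exists_first_exit (fun z => F z ∈ D.beyond i s) (fun k => z - k)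
    ⟨(z - y).val, by simpa using hy⟩ (by simpa using hz)
  have hb2 : F (z + (b + 1 : ℕ)) = D.pt s :=
    D.eq_pt_of_adj_beyond hb0 (by simpa [add_assoc] using hF (z + b)) hb1
  have ha2 : F (z - (a + 1 : ℕ)) = D.pt s := by
    refine D.eq_pt_of_adj_beyond ha0 ?_ ha1
    have := hF (z - (a + 1 : ℕ))
    have e : z - (a + 1 : ℕ) + 1 = z - a := by push_cast; ring
    rw [e] at this
    exact this.imp Eq.symm Adj.symm
  have hin : ∀ k ≤ a + b, F (z - a + k) ∈ D.beyond i s := by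
    intro k hk
    rcases le_total k a with h | h
    · have := ha (a - k) (by omega)
      rw [Nat.cast_sub h] at this
      convert this using 2
      ring
    · have := hb (k - a) (by omega)
      rw [Nat.cast_sub h] at this
      convert this using 2
      ring
  have hab : 2 * (a + b + 1) ≤ N := by
    by_contra! hlt
    -- The minimum with `N` handles a run that might a priori wrap around the whole circle.
    have hinj : Set.InjOn (fun k : ℕ => z - a + (k : ZMod N))
        (Finset.range (min (a + b + 1) N) : Set ℕ) := by
      intro k hk l hl hkl
      have hk' := (lt_min_iff.1 (Finset.mem_range.1 hk)).2
      have hl' := (lt_min_iff.1 (Finset.mem_range.1 hl)).2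
      have := (ZMod.natCast_eq_natCast_iff' k l N).1 (add_left_cancel hkl)
      rwa [Nat.mod_eq_of_lt hk', Nat.mod_eq_of_lt hl'] at this
    have hle := Finset.card_le_card_of_injOn (s := Finset.range (min (a + b + 1) N))
      (t := Finset.univ.filter fun z => F z ∈ D.beyond i s) _
      (fun k hk => by
        have := (lt_min_iff.1 (Finset.mem_range.1 hk)).1
        simpa using hin k (by omega)) hinj
    rw [Finset.card_range] at hle
    omega
  have hgap : a + b + 2 ≤ δ := by
    -- With its two ends the run may slightly exceed half of the circle. Then the complementary arc
    -- is short enough for `hδ`, and its length would contradict `hN`.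
    by_cases h2 : 2 * (a + b + 2) ≤ N
    · have h3 := hδ (z - (a + 1 : ℕ)) (a + b + 2) h2
      have e : z - (a + 1 : ℕ) + (a + b + 2 : ℕ) = z + (b + 1 : ℕ) := by push_cast; ring
      rw [e, ha2, hb2, dist_self] at h3
      omega
    · have h3 := hδ (z + (b + 1 : ℕ)) (N - (a + b + 2)) (by omega)
      have e : z + (b + 1 : ℕ) + (N - (a + b + 2) : ℕ) = z - (a + 1 : ℕ) := by
        rw [Nat.cast_sub (by omega)]
        push_cast
        rw [ZMod.natCast_self]
        ring
      rw [e, ha2, hb2, dist_self] at h3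
      omega
  have := hF.dist_le hX z (b + 1)
  rw [hb2] at this
  omega

/-- A vertex of a branch is either beyond its cut vertex, where the excursion bound `δ` applies, or
within `B` of it by definition of a decomposition. -/
theorem exists_piece (D : StarDecomposition X Γ S B) (hX : X.Connected) {F : ZMod N → W}
    (hF : X.IsLazyCycle F) {δ : ℕ} (hδ : X.IsQuasiIsometric F δ) (hN : 2 * δ + 2 < N) :
    ∃ i, ∀ s z, F z ∈ D.branch i s → X.dist (F z) (D.pt s) ≤ δ + B := by
  classical
  obtain ⟨i, hi⟩ := D.exists_central_piece hX F
  refine ⟨i, fun s z hz => ?_⟩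
  by_cases hb : F z ∈ D.beyond i s
  · exact (D.dist_pt_le_of_beyond hX hF hδ hN (hi s) hb).trans (Nat.le_add_right _ _)
  · refine (D.dist_pt_le i s _ hz ?_).trans (Nat.le_add_left _ _)
    by_contra! h
    exact hb h

end Median

/-- Linear lower bounds on the additive error pass from the pieces to the whole graph. -/
theorem noQuasiIsometricCycles (D : StarDecomposition X Γ S B) (hX : X.Connected)
    (hΓ : ∀ i, (Γ i).Connected) {c : ℕ} (hc : ∀ i, (Γ i).NoQuasiIsometricCycles c) :
    X.NoQuasiIsometricCycles (6 * c + 8 * c * B + 6) := by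
  intro N δ F hN hcδ hF hδ
  have : NeZero N := ⟨by omega⟩
  have h6 : 6 * (c * δ) + 6 * δ ≤ N := by nlinarith [Nat.zero_le (8 * c * B * δ)]
  obtain ⟨i, hi⟩ := D.exists_piece hX hF hδ (by omega)
  have hclose : ∀ z, X.dist (F z) (D.emb i (D.retr i (F z))) ≤ δ + 2 * B := by
    intro z
    by_cases hz : F z ∈ Set.range (D.emb i)
    · obtain ⟨a, ha⟩ := hz
      rw [← ha, D.retr_emb, dist_self]
      omega
    · obtain ⟨s, hs⟩ := D.exists_mem_branch i _ hz
      have h1 := hi s z hs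
      have h2 := D.dist_retr_le i s _ hs
      have h3 := hX.dist_triangle (u := F z) (v := D.pt s) (w := D.emb i (D.retr i (F z)))
      rw [X.dist_comm (u := D.pt s)] at h3
      omega
  -- The error `δ` grows by the displacement `δ + 2 * B` at both ends. In the constant of the
  -- theorem, `6 * c` times `δ` pays for `3 * δ`, while `N` being larger than `8 * c * B` pays for
  -- `4 * B`.
  refine hc i N (3 * δ + 4 * B) (fun z => D.retr i (F z)) (by nlinarith) ?_ ?_ ?_
  · have : 8 * (c * B) ≤ N := by nlinarith
    have e : c * (3 * δ + 4 * B) = 3 * (c * δ) + 4 * (c * B) := by ring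
    omega
  · intro z
    rcases hF z with h | h
    · exact Or.inl (congrArg _ h)
    · exact D.retr_adj i _ _ h
  · intro z k hk
    have h0 := hδ z k hk
    change k ≤ (Γ i).dist (D.retr i (F z)) (D.retr i (F (z + k))) + _
    rw [← D.dist_emb hX hΓ]
    have h1 := hclose z
    have h2 := hclose (z + k)
    have h3 := hX.dist_triangle (u := F z) (v := D.emb i (D.retr i (F z))) (w := F (z + k))
    have h4 := hX.dist_triangle (u := D.emb i (D.retr i (F z)))
      (v := D.emb i (D.retr i (F (z + k)))) (w := F (z + k))
    rw [X.dist_comm (v := F (z + k)) (u := D.emb i (D.retr i (F (z + k))))] at h4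
    omega

/-- Long isometric cycles lie in a piece. -/
theorem exists_piece_of_isometric (D : StarDecomposition X Γ S B) (hX : X.Connected)
    (hΓ : ∀ i, (Γ i).Connected) {N : ℕ} (hN : 4 * B + 6 < N) {F : ZMod N → W}
    (hF : X.IsLazyCycle F) (hδ : X.IsQuasiIsometric F 0) :
    ∃ i, ∀ z, F z ∈ Set.range (D.emb i) := by
  have : NeZero N := ⟨by omega⟩
  obtain ⟨i, hi⟩ := D.exists_piece hX hF hδ (by omega)
  refine ⟨i, ?_⟩
  -- While outside the piece the cycle stays in one branch, thus within `B` of one cut vertex. An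
  -- isometric run of `2 * B + 1` steps cannot do so.
  have hrun : ∀ z, ∃ k ≤ 2 * B + 1, F (z + k) ∈ Set.range (D.emb i) := by
    intro z
    by_contra! h
    obtain ⟨s, hs⟩ := D.exists_mem_branch i (F z) (by simpa using h 0 (by omega))
    have hall : ∀ k : ℕ, k ≤ 2 * B + 1 → F (z + k) ∈ D.branch i s := by
      intro k
      induction k with
      | zero => intro _; simpa using hs
      | succ k ih =>
        intro hk
        have h1 := ih (by omega)
        have h2 := h (k + 1) hk
        push_cast at h2 ⊢
        rw [← add_assoc] at h2 ⊢
        rcases hF (z + k) with h3 | h3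
        · rwa [← h3]
        · exact D.mem_branch_of_adj i s _ _ h1 h3 h2
    have h1 := hi s z hs
    have h2 := hi s _ (hall _ le_rfl)
    have h3 := hδ z (2 * B + 1) (by omega)
    have h4 := hX.dist_triangle (u := F z) (v := D.pt s) (w := F (z + (2 * B + 1 : ℕ)))
    rw [X.dist_comm (u := D.pt s)] at h4
    omega
  -- If the cycle leaves the piece at `emb a` and is at `emb b` after `k + 1` steps, the retraction
  -- sends its first vertex outside to `a`, whence `a` and `b` are at distance at most `k`. Isometry
  -- demands `k + 1`.
  have hstep : ∀ z, F z ∈ Set.range (D.emb i) → F (z + 1) ∈ Set.range (D.emb i) := by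
    intro z hz
    by_contra hz1
    obtain ⟨k, hk, b, hb⟩ := hrun (z + 1)
    obtain ⟨a, ha⟩ := hz
    have hadj : X.Adj (F z) (F (z + 1)) := by
      rcases hF z with h | h
      · exact absurd ⟨a, ha.trans h⟩ hz1
      · exact h
    rw [← ha] at hadj
    have hra := D.retr_eq_of_adj i a _ hadj hz1
    have h1 := hF.dist_le hX (z + 1) k
    have h2 := dist_le_of_lazy_map hX (hΓ i) _ (D.retr_adj i) (F (z + 1)) (F (z + 1 + k))
    have h3 := hδ z (k + 1) (by omega)
    have e : z + (k + 1 : ℕ) = z + 1 + k := by push_cast; ring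
    rw [e, ← hb, ← ha, D.dist_emb hX hΓ] at h3
    rw [hra, ← hb, D.retr_emb] at h2
    rw [← hb] at h1
    omega
  obtain ⟨k, -, hk⟩ := hrun 0
  intro z
  have hall : ∀ l : ℕ, F (0 + k + l) ∈ Set.range (D.emb i) := by
    intro l
    induction l with
    | zero => simpa using hk
    | succ l ih =>
      have := hstep _ ih
      rwa [add_assoc, ← Nat.cast_succ] at this
  simpa using hall (z - k).val

end StarDecomposition

end SimpleGraph

/-! ### Cycles with real parameters and lazy cycles -/

namespace ShortcutGraph

open SimpleGraph

variable {V : Type*} {V' : Type*}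

/-- With `dist_le_pointDist`, this compares real parameters with vertices up to the two offsets, so
that the metric conditions on a cycle can be handled on its vertices. -/
theorem pointDist_le {Γ : SimpleGraph V} (p q : EdgePoint Γ) :
    pointDist p q ≤ p.offset + Γ.dist p.dart.fst q.dart.fst + q.offset := by
  have h : min (distToVertex p q.dart.fst + q.offset) (distToVertex p q.dart.snd + (1 - q.offset)) ≤
      p.offset + Γ.dist p.dart.fst q.dart.fst + q.offset :=
    (min_le_left _ _).trans (add_le_add_left (min_le_left _ _) _)
  unfold pointDist
  dsimp only
  split_ifs
  · exact (min_le_left _ _).trans h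
  · exact (min_le_left _ _).trans h
  · exact h

theorem dist_le_distToVertex {Γ : SimpleGraph V} (hΓ : Γ.Connected) (p : EdgePoint Γ) (v : V) :
    (Γ.dist p.dart.fst v : ℝ) ≤ distToVertex p v + p.offset := by
  have h0 := p.offset_nonneg
  have h1 : (Γ.dist p.dart.fst v : ℝ) ≤ 1 + Γ.dist p.dart.snd v := by
    have := hΓ.dist_triangle (u := p.dart.fst) (v := p.dart.snd) (w := v)
    rw [dist_eq_one_iff_adj.2 p.dart.adj] at this
    exact_mod_cast this
  unfold distToVertex
  rcases min_choice (p.offset + (Γ.dist p.dart.fst v : ℝ))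
    ((1 - p.offset) + (Γ.dist p.dart.snd v : ℝ)) with h | h <;> rw [h] <;> linarith

theorem dist_le_pointDist {Γ : SimpleGraph V} (hΓ : Γ.Connected) (p q : EdgePoint Γ) :
    (Γ.dist p.dart.fst q.dart.fst : ℝ) ≤ pointDist p q + p.offset + q.offset := by
  have hp0 := p.offset_nonneg
  have hq0 := q.offset_nonneg
  have hq1 := q.offset_le_one
  have h : (Γ.dist p.dart.fst q.dart.fst : ℝ) - p.offset - q.offset ≤
      min (distToVertex p q.dart.fst + q.offset) (distToVertex p q.dart.snd + (1 - q.offset)) := by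
    have h1 := dist_le_distToVertex hΓ p q.dart.fst
    have h2 := dist_le_distToVertex hΓ p q.dart.snd
    have h3 : (Γ.dist p.dart.fst q.dart.fst : ℝ) ≤ Γ.dist p.dart.fst q.dart.snd + 1 := by
      have := hΓ.dist_triangle (u := p.dart.fst) (v := q.dart.snd) (w := q.dart.fst)
      rw [dist_eq_one_iff_adj.2 q.dart.adj.symm] at this
      exact_mod_cast this
    refine le_min ?_ ?_ <;> linarith
  suffices (Γ.dist p.dart.fst q.dart.fst : ℝ) - p.offset - q.offset ≤ pointDist p q by linarith
  unfold pointDist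
  dsimp only
  split_ifs with h1 h2
  · refine le_min h ?_
    rw [h1, dist_self]
    have := abs_nonneg (p.offset - q.offset)
    push_cast
    linarith
  · refine le_min h ?_
    have h3 : Γ.dist p.dart.fst q.dart.fst = 1 := by
      rw [h2]
      exact dist_eq_one_iff_adj.2 q.dart.adj.symm
    rw [h3]
    have := neg_abs_le (p.offset - (1 - q.offset))
    push_cast
    linarith
  · exact h

/-- An injective map preserves and reflects coincidence of darts and of reversed darts, so the same
case of `pointDist` applies on both sides. -/
theorem pointDist_comp {Γ : SimpleGraph V} {Γ' : SimpleGraph V'} {φ : V' → V}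
    (hφ : Function.Injective φ) (hdist : ∀ a b, Γ.dist (φ a) (φ b) = Γ'.dist a b)
    {p q : EdgePoint Γ} {p' q' : EdgePoint Γ'} (hp : p.offset = p'.offset)
    (hq : q.offset = q'.offset) (hp1 : p.dart.fst = φ p'.dart.fst)
    (hp2 : p.dart.snd = φ p'.dart.snd) (hq1 : q.dart.fst = φ q'.dart.fst)
    (hq2 : q.dart.snd = φ q'.dart.snd) : pointDist p q = pointDist p' q' := by
  have h1 : p.dart = q.dart ↔ p'.dart = q'.dart := by
    rw [Dart.ext_iff, Dart.ext_iff, Prod.ext_iff, Prod.ext_iff, hp1, hp2, hq1, hq2,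
      hφ.eq_iff, hφ.eq_iff]
  have h2 : p.dart = q.dart.symm ↔ p'.dart = q'.dart.symm := by
    rw [Dart.ext_iff, Dart.ext_iff, Prod.ext_iff, Prod.ext_iff]
    simp only [Dart.symm_toProd, Prod.fst_swap, Prod.snd_swap]
    rw [hp1, hp2, hq1, hq2, hφ.eq_iff, hφ.eq_iff]
  unfold pointDist distToVertex
  simp only [hp, hq, hp1, hp2, hq1, hq2, hdist]
  by_cases c1 : p'.dart = q'.dart
  · rw [if_pos c1, if_pos (h1.2 c1)]
  · rw [if_neg c1, if_neg (mt h1.1 c1)]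
    by_cases c2 : p'.dart = q'.dart.symm
    · rw [if_pos c2, if_pos (h2.2 c2)]
    · rw [if_neg c2, if_neg (mt h2.1 c2)]

@[simp]
theorem Cycle.point_fst {Γ : SimpleGraph V} {n : ℕ} (f : Cycle Γ n) (m : ℕ) :
    (f.point (m : ℝ)).dart.fst = f.vertex m := by
  simp [Cycle.point]

@[simp]
theorem Cycle.point_offset {Γ : SimpleGraph V} {n : ℕ} (f : Cycle Γ n) (m : ℕ) :
    (f.point (m : ℝ)).offset = 0 := by
  simp [Cycle.point]

theorem Cycle.isLazyCycle {Γ : SimpleGraph V} {n : ℕ} (f : Cycle Γ n) : Γ.IsLazyCycle f.vertex :=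
  fun z => Or.inr (f.adj z)

theorem Cycle.IsIsometric.isQuasiIsometric {Γ : SimpleGraph V} {n : ℕ}
    (hn : 0 < n) {f : Cycle Γ n} (hf : f.IsIsometric) : Γ.IsQuasiIsometric f.vertex 0 := by
  intro z k hk
  have : NeZero n := ⟨hn.ne'⟩
  have h1 := hf ((z.val : ℕ) : ℝ) ((z.val + k : ℕ) : ℝ)
  have h2 := pointDist_le (f.point ((z.val : ℕ) : ℝ)) (f.point ((z.val + k : ℕ) : ℝ))
  have h3 : dist (((z.val : ℕ) : ℝ) : AddCircle (n : ℝ)) (((z.val + k : ℕ) : ℝ) : AddCircle (n : ℝ))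
      = k := by
    rw [_root_.dist_comm, dist_eq_norm, ← AddCircle.coe_sub]
    have e : ((z.val + k : ℕ) : ℝ) - ((z.val : ℕ) : ℝ) = k := by push_cast; ring
    rw [e, (AddCircle.norm_coe_eq_abs_iff (n : ℝ) (by positivity)).2, abs_of_nonneg (by positivity)]
    rw [abs_of_nonneg (by positivity), abs_of_nonneg (by positivity), le_div_iff₀ two_pos]
    exact_mod_cast (mul_comm k 2).trans_le hk
  rw [h1, h3] at h2
  simp only [Cycle.point_fst, Cycle.point_offset, zero_add, add_zero] at h2
  rw [Nat.cast_add, ZMod.natCast_zmod_val] at h2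
  exact_mod_cast h2

theorem Cycle.IsIsometric.of_comp {Γ : SimpleGraph V} {Γ' : SimpleGraph V'} {φ : V' → V}
    (hφ : Function.Injective φ) (hdist : ∀ a b, Γ.dist (φ a) (φ b) = Γ'.dist a b) {n : ℕ}
    {f : Cycle Γ n} {f' : Cycle Γ' n} (h : ∀ z, f.vertex z = φ (f'.vertex z)) (hf : f.IsIsometric) :
    f'.IsIsometric := fun s t => by
  rw [← hf s t]
  exact (pointDist_comp hφ hdist rfl rfl (h _) (h _) (h _) (h _)).symm

theorem isShortcutGraph_of_starDecomposition {X : SimpleGraph V} (hX : X.Connected) {I : Type*}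
    {P : I → Type*} {Γ : ∀ i, SimpleGraph (P i)} {S : Type*} {B : ℕ}
    (D : StarDecomposition X Γ S B) (hΓ : ∀ i, (Γ i).Connected) (θ : ℕ)
    (hθ : ∀ i n, 0 < n → ∀ f : Cycle (Γ i) n, f.IsIsometric → n ≤ θ) : IsShortcutGraph X := by
  refine ⟨hX, θ + (4 * B + 6), fun n hn f hf => ?_⟩
  by_contra! hlt
  obtain ⟨i, hi⟩ := D.exists_piece_of_isometric hX hΓ (by omega) f.isLazyCycle
    (hf.isQuasiIsometric hn)
  choose g hg using hi
  have hadj : ∀ z, (Γ i).Adj (g z) (g (z + 1)) := fun z => by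
    rw [← D.adj_emb_iff, hg, hg]
    exact f.adj z
  have := hθ i n hn ⟨g, hadj⟩
    (hf.of_comp (D.emb_injective i) (D.dist_emb hX hΓ i) fun z => (hg z).symm)
  omega

/-! ### Strongly shortcut graphs -/

/-- By the triangle inequality, the defect of distance over an arc of at most half the length is
bounded, up to rounding, by the defect at the antipode. It thus suffices to choose `ξ` close to `1`
in terms of `c`. -/
theorem isStronglyShortcutGraph_of_noQuasiIsometricCycles {Γ : SimpleGraph V} (hΓ : Γ.Connected)
    {c : ℕ} (hc : Γ.NoQuasiIsometricCycles c) : IsStronglyShortcutGraph Γ := by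
  have hc0 : (0 : ℝ) < c + 2 := by positivity
  refine ⟨hΓ, 4 * c, 1 - 1 / (c + 2), ?_, ?_, fun n hn f hf => ?_⟩
  · rw [sub_pos, div_lt_one hc0]
    have : (0 : ℝ) ≤ c := by positivity
    linarith
  · have : 0 < 1 / ((c : ℝ) + 2) := by positivity
    linarith
  by_contra! hlt
  have : NeZero n := ⟨hn.ne'⟩
  -- This is the antipodal defect `(1 - ξ) * n / 2`, plus `1` for the offset of the antipodal point.
  -- The bound `4 * c < n` leaves room for rounding in `c * ⌈E⌉₊ ≤ n`.
  set E : ℝ := (1 / (c + 2)) * (n / 2) + 1 with hE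
  have hE0 : 0 ≤ E := by positivity
  refine hc n ⌈E⌉₊ f.vertex (by omega) ?_ f.isLazyCycle ?_
  · have h1 : (⌈E⌉₊ : ℝ) ≤ E + 1 := (Nat.ceil_lt_add_one hE0).le
    have h2 : (c : ℝ) * (1 / (c + 2)) ≤ 1 := by
      rw [mul_one_div, div_le_one hc0]
      linarith
    have h3 : (4 * c : ℝ) ≤ n := by exact_mod_cast hlt.le
    have h4 : (c : ℝ) * ⌈E⌉₊ ≤ n := by
      have hc' : (0 : ℝ) ≤ c := by positivity
      have hn' : (0 : ℝ) ≤ n / 2 := by positivity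
      have h5 := mul_le_mul_of_nonneg_left h1 hc'
      have h6 := mul_le_mul_of_nonneg_right h2 hn'
      rw [hE] at h5
      nlinarith
    exact_mod_cast h4
  · intro z k hk
    have h1 := hf ((z.val : ℕ) : ℝ)
    have h2 := pointDist_le (f.point ((z.val : ℕ) : ℝ)) (f.point (((z.val : ℕ) : ℝ) + (n : ℝ) / 2))
    have h3 := (f.point (((z.val : ℕ) : ℝ) + (n : ℝ) / 2)).offset_le_one
    have hfl : ⌊((z.val : ℕ) : ℝ) + (n : ℝ) / 2⌋ = ((z.val + n / 2 : ℕ) : ℤ) := by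
      rw [Int.floor_natCast_add, Nat.cast_add]
      congr 1
      rw [Int.floor_eq_iff]
      have h5 : (((n / 2 : ℕ) : ℤ) : ℝ) * 2 ≤ n ∧ (n : ℝ) ≤ ((n / 2 : ℕ) : ℤ) * 2 + 1 := by
        constructor <;> norm_cast <;> omega
      constructor <;> linarith [h5.1, h5.2]
    have h4 : (f.point (((z.val : ℕ) : ℝ) + (n : ℝ) / 2)).dart.fst = f.vertex (z + (n / 2 : ℕ)) := by
      change f.vertex ((⌊((z.val : ℕ) : ℝ) + (n : ℝ) / 2⌋ : ℤ) : ZMod n) = _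
      rw [hfl, Int.cast_natCast, Nat.cast_add, ZMod.natCast_zmod_val]
    rw [h4, Cycle.point_fst, Cycle.point_offset, ZMod.natCast_zmod_val, zero_add] at h2
    have h5 := f.isLazyCycle.dist_le hΓ (z + k) (n / 2 - k)
    have e : z + k + (n / 2 - k : ℕ) = z + (n / 2 : ℕ) := by
      rw [Nat.cast_sub (by omega)]
      ring
    rw [e] at h5
    have h6 := hΓ.dist_triangle (u := f.vertex z) (v := f.vertex (z + k))
      (w := f.vertex (z + (n / 2 : ℕ)))
    have h7 : Γ.dist (f.vertex z) (f.vertex (z + (n / 2 : ℕ))) + k ≤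
        Γ.dist (f.vertex z) (f.vertex (z + k)) + n / 2 := by omega
    have h8 : ((n / 2 : ℕ) : ℝ) ≤ n / 2 := Nat.cast_div_le
    have h9 : (Γ.dist (f.vertex z) (f.vertex (z + (n / 2 : ℕ))) : ℝ) + k ≤
        Γ.dist (f.vertex z) (f.vertex (z + k)) + ((n / 2 : ℕ) : ℝ) := by exact_mod_cast h7
    have h10 : E ≤ ⌈E⌉₊ := Nat.le_ceil E
    have h11 : (k : ℝ) ≤ Γ.dist (f.vertex z) (f.vertex (z + k)) + ⌈E⌉₊ := by
      rw [hE] at h10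
      linarith
    exact_mod_cast h11

/-! ### Removal of stationary steps: changing the parity of the length -/

section Pad

variable {N : ℕ}

/-- Wait once at the base point of a cycle. -/
def pad (F : ZMod N → V) (z : ZMod (N + 1)) : V :=
  F ((z.val : ℕ) : ZMod N)

theorem pad_natCast (F : ZMod N → V) {j : ℕ} (hj : j ≤ N) : pad F (j : ZMod (N + 1)) = F j := by
  unfold pad
  rw [ZMod.val_natCast, Nat.mod_eq_of_lt (by omega)]

theorem pad_add_one (F : ZMod N → V) (z : ZMod (N + 1)) :
    pad F (z + 1) = if z.val = N then pad F z else F (((z.val : ℕ) : ZMod N) + 1) := by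
  have hz : z.val < N + 1 := ZMod.val_lt z
  have e : z + 1 = ((z.val + 1 : ℕ) : ZMod (N + 1)) := by
    push_cast
    rw [ZMod.natCast_zmod_val]
  split_ifs with h
  · rw [e, h, ZMod.natCast_self, pad, pad, h, ZMod.natCast_self, ZMod.val_zero, Nat.cast_zero]
  · rw [e, pad_natCast F (by omega), Nat.cast_succ]

theorem isLazyCycle_pad {Γ : SimpleGraph V} {F : ZMod N → V} (hF : Γ.IsLazyCycle F) :
    Γ.IsLazyCycle (pad F) := by
  intro z
  rw [pad_add_one]
  split_ifs with h
  · exact Or.inl rfl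
  · exact hF _

/-- Waiting once shifts the indices along an arc by at most one, which costs one unit. Another unit
is lost because `hδ` is applied to `k - 1`: the half-length of the padded cycle may exceed that of
the original one. -/
theorem isQuasiIsometric_pad {Γ : SimpleGraph V} (hΓ : Γ.Connected) {F : ZMod N → V}
    (hF : Γ.IsLazyCycle F) {δ : ℕ} (hδ : Γ.IsQuasiIsometric F δ) :
    Γ.IsQuasiIsometric (pad F) (δ + 2) := by
  intro z k hk
  have hz : z.val < N + 1 := ZMod.val_lt z
  have hz0 : pad F z = F ((z.val : ℕ) : ZMod N) := rfl
  have e : z + k = ((z.val + k : ℕ) : ZMod (N + 1)) := by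
    push_cast
    rw [ZMod.natCast_zmod_val]
  have hshift : pad F (z + k) = F ((z.val : ℕ) + (k : ZMod N)) ∨
      1 ≤ k ∧ pad F (z + k) = F ((z.val : ℕ) + ((k - 1 : ℕ) : ZMod N)) := by
    rcases Nat.lt_or_ge N (z.val + k) with h | h
    · refine Or.inr ⟨by omega, ?_⟩
      obtain ⟨l, hl⟩ := Nat.exists_eq_add_of_lt h
      rw [e, show z.val + k = N + 1 + l by omega, Nat.cast_add, ZMod.natCast_self, zero_add,
        pad_natCast F (by omega)]
      congr 1
      have h1 : z.val + (k - 1) = N + l := by omega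
      rw [← Nat.cast_add, h1, Nat.cast_add, ZMod.natCast_self, zero_add]
    · left
      rw [e, pad_natCast F h, Nat.cast_add]
  rw [hz0]
  rcases Nat.eq_zero_or_pos k with rfl | hk0
  · omega
  have h1 := hδ ((z.val : ℕ) : ZMod N) (k - 1) (by omega)
  rcases hshift with h | ⟨-, h⟩
  · rw [h]
    have h2 := dist_le_one_of_eq_or_adj (hF ((z.val : ℕ) + ((k - 1 : ℕ) : ZMod N)))
    have h3 : ((z.val : ℕ) : ZMod N) + ((k - 1 : ℕ) : ZMod N) + 1 = (z.val : ℕ) + (k : ZMod N) := by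
      rw [Nat.cast_sub hk0]
      push_cast
      ring
    rw [h3] at h2
    have h4 := hΓ.dist_triangle (u := F ((z.val : ℕ) : ZMod N)) (v := F ((z.val : ℕ) + (k : ZMod N)))
      (w := F ((z.val : ℕ) + ((k - 1 : ℕ) : ZMod N)))
    rw [Γ.dist_comm (u := F ((z.val : ℕ) + (k : ZMod N)))] at h4
    omega
  · rw [h]
    omega

end Pad

/-! ### Removal of stationary steps: an even number of waits -/

section Toggle

open Classical in
/-- The number of times that a cycle of length `N` waits among the first `j` steps. -/
noncomputable def waits {N : ℕ} (F : ZMod N → V) (j : ℕ) : ℕ :=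
  Nat.count (fun k : ℕ => F k = F (k + 1)) j

theorem waits_pad {N : ℕ} (F : ZMod N → V) : waits (pad F) (N + 1) = waits F N + 1 := by
  classical
  unfold waits
  rw [Nat.count_succ, if_pos]
  · congr 1
    rw [Nat.count_eq_card_filter_range, Nat.count_eq_card_filter_range]
    congr 1
    refine Finset.filter_congr fun k hk => ?_
    have hk' : k < N := Finset.mem_range.1 hk
    rw [pad_natCast F hk'.le, ← Nat.cast_succ, pad_natCast F hk', Nat.cast_succ]
  · rw [← Nat.cast_succ, ZMod.natCast_self, pad_natCast F le_rfl]
    simp [pad]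

/-- A lazy cycle that waits an even number of times is close to a cycle that never waits. -/
theorem exists_cycle_of_even_waits {Γ : SimpleGraph V} (hΓ : ∀ v, ∃ w, Γ.Adj v w) {N : ℕ}
    [NeZero N] {F : ZMod N → V} (hF : Γ.IsLazyCycle F) (heven : Even (waits F N)) :
    ∃ f : Cycle Γ N, ∀ z, Γ.dist (F z) (f.vertex z) ≤ 1 := by
  classical
  choose nb hnb using hΓ
  have hstate : ∀ z : ZMod N, Even (waits F (z + 1).val) ↔
      (Even (waits F z.val) ↔ ¬ F z = F (z + 1)) := by
    intro z
    have h1 : Even (waits F (z + 1).val) ↔ Even (waits F (z.val + 1)) := by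
      by_cases h : z.val + 1 = N
      · have hz : z + 1 = 0 := by
          rw [← ZMod.natCast_zmod_val z, ← Nat.cast_succ, Nat.succ_eq_add_one, h, ZMod.natCast_self]
        rw [hz, h]
        simpa [waits] using heven
      · have hlt : z.val + 1 < N := lt_of_le_of_ne (ZMod.val_lt z) h
        have : (z + 1).val = z.val + 1 := by
          conv_lhs => rw [← ZMod.natCast_zmod_val z, ← Nat.cast_succ]
          rw [ZMod.val_natCast, Nat.mod_eq_of_lt hlt]
        rw [this]
    rw [h1, waits, Nat.count_succ, ZMod.natCast_zmod_val]
    change Even (waits F z.val + _) ↔ _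
    split_ifs with h
    · simp [h, Nat.even_add_one]
    · simp [h]
  let g : ZMod N → V := fun z =>
    if Even (waits F z.val) then F z else if F (z - 1) = F z then nb (F z) else F (z - 1)
  have hodd : ∀ z, ¬ Even (waits F z.val) → Γ.Adj (F z) (g z) := by
    intro z hz
    simp only [g, if_neg hz]
    split_ifs with h
    · exact hnb _
    · have := hF (z - 1)
      rw [sub_add_cancel] at this
      exact (this.resolve_left h).symm
  have hev : ∀ z, Even (waits F z.val) → g z = F z := fun z hz => if_pos hz
  refine ⟨⟨g, fun z => ?_⟩, fun z => ?_⟩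
  · have hs := hstate z
    by_cases hz : Even (waits F z.val)
    · rw [hev z hz]
      by_cases hw : F z = F (z + 1)
      · rw [hw]
        exact hodd _ (by simp [hs, hz, hw])
      · rw [hev _ (by simp [hs, hz, hw])]
        exact (hF z).resolve_left hw
    · by_cases hw : F z = F (z + 1)
      · rw [hev (z + 1) (by simp [hs, hz, hw]), ← hw]
        exact (hodd z hz).symm
      · have hz1 : ¬ Even (waits F (z + 1).val) := by simp [hs, hz, hw]
        have : g (z + 1) = F z := by
          simp only [g, if_neg hz1, add_sub_cancel_right, if_neg hw]
        rw [this]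
        exact (hodd z hz).symm
  · change Γ.dist (F z) (g z) ≤ 1
    by_cases hz : Even (waits F z.val)
    · rw [hev z hz, dist_self]
      exact zero_le_one
    · exact (dist_eq_one_iff_adj.2 (hodd z hz)).le

end Toggle

theorem isQuasiIsometric_of_dist_le_one {Γ : SimpleGraph V} (hΓ : Γ.Connected) {N : ℕ}
    {F F' : ZMod N → V} {δ : ℕ} (hδ : Γ.IsQuasiIsometric F δ) (h : ∀ z, Γ.dist (F z) (F' z) ≤ 1) :
    Γ.IsQuasiIsometric F' (δ + 2) := by
  intro z k hk
  have h0 := hδ z k hk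
  have h1 := h z
  have h2 := h (z + k)
  have h3 := hΓ.dist_triangle (u := F z) (v := F' z) (w := F (z + k))
  have h4 := hΓ.dist_triangle (u := F' z) (v := F' (z + k)) (w := F (z + k))
  rw [Γ.dist_comm (u := F' (z + k))] at h4
  omega

/-- The summand `4` absorbs the two offsets, at most `2` together, and the rounding of `t` and of `N
/ 2`, which costs at most `3 / 2`. -/
theorem Cycle.isAlmostIsometric_of_isQuasiIsometric {Γ : SimpleGraph V} (hΓ : Γ.Connected) {N : ℕ}
    {f : Cycle Γ N} {δ : ℕ} (hδ : Γ.IsQuasiIsometric f.vertex δ) {ξ : ℝ}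
    (hξ : (δ : ℝ) + 4 ≤ (1 - ξ) * (N / 2)) : f.IsAlmostIsometric ξ := by
  intro t
  have h1 := dist_le_pointDist hΓ (f.point t) (f.point (t + (N : ℝ) / 2))
  have h2 := (f.point t).offset_le_one
  have h3 := (f.point (t + (N : ℝ) / 2)).offset_le_one
  obtain ⟨ε, hε, hfl⟩ : ∃ ε : ℕ, ε ≤ 1 ∧ ⌊t + (N : ℝ) / 2⌋ = ⌊t⌋ + ((N / 2 : ℕ) : ℤ) + (ε : ℤ) := by
    have hN : (((N / 2 : ℕ) : ℤ) : ℝ) * 2 ≤ N ∧ (N : ℝ) ≤ ((N / 2 : ℕ) : ℤ) * 2 + 1 := by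
      constructor <;> norm_cast <;> omega
    have hl : ⌊t⌋ + ((N / 2 : ℕ) : ℤ) ≤ ⌊t + (N : ℝ) / 2⌋ := by
      rw [Int.le_floor, Int.cast_add]
      have := Int.floor_le t
      linarith
    have hu : ⌊t + (N : ℝ) / 2⌋ < ⌊t⌋ + ((N / 2 : ℕ) : ℤ) + 2 := by
      rw [Int.floor_lt, Int.cast_add, Int.cast_add]
      have := Int.lt_floor_add_one t
      push_cast at hN ⊢
      linarith
    exact ⟨(⌊t + (N : ℝ) / 2⌋ - ⌊t⌋ - ((N / 2 : ℕ) : ℤ)).toNat, by omega, by omega⟩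
  have h4 : (f.point (t + (N : ℝ) / 2)).dart.fst =
      f.vertex ((⌊t⌋ : ZMod N) + (N / 2 : ℕ) + (ε : ℕ)) := by
    change f.vertex ((⌊t + (N : ℝ) / 2⌋ : ℤ) : ZMod N) = _
    rw [hfl, Int.cast_add, Int.cast_add, Int.cast_natCast, Int.cast_natCast]
  have h5 : (f.point t).dart.fst = f.vertex (⌊t⌋ : ZMod N) := rfl
  rw [h4, h5] at h1
  have h6 := hδ (⌊t⌋ : ZMod N) (N / 2) (by omega)
  have h7 := f.isLazyCycle.dist_le hΓ ((⌊t⌋ : ZMod N) + (N / 2 : ℕ)) ε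
  have h8 := hΓ.dist_triangle (u := f.vertex (⌊t⌋ : ZMod N))
    (v := f.vertex ((⌊t⌋ : ZMod N) + (N / 2 : ℕ) + (ε : ℕ)))
    (w := f.vertex ((⌊t⌋ : ZMod N) + (N / 2 : ℕ)))
  rw [Γ.dist_comm (u := f.vertex ((⌊t⌋ : ZMod N) + (N / 2 : ℕ) + (ε : ℕ)))] at h8
  have h9 : N ≤ 2 * (Γ.dist (f.vertex (⌊t⌋ : ZMod N))
    (f.vertex ((⌊t⌋ : ZMod N) + (N / 2 : ℕ) + (ε : ℕ)))) + 2 * δ + 3 := by omega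
  have h10 : (N : ℝ) ≤ 2 * (Γ.dist (f.vertex (⌊t⌋ : ZMod N))
    (f.vertex ((⌊t⌋ : ZMod N) + (N / 2 : ℕ) + (ε : ℕ))) : ℝ) + 2 * δ + 3 := by exact_mod_cast h9
  linarith

/-- A lazy cycle with small error is padded to an even number of waits and freed of them. Each
operation adds `2` to the error, so the result is still almost isometric and its length is bounded.
-/
theorem IsStronglyShortcutGraph.exists_noQuasiIsometricCycles {Γ : SimpleGraph V}
    (h : IsStronglyShortcutGraph Γ) : ∃ c, Γ.NoQuasiIsometricCycles c := by
  obtain ⟨hΓ, θ, ξ, hξ0, hξ1, hθ⟩ := h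
  have hη : 0 < 1 - ξ := by linarith
  -- The final cycle has error `δ + 4`, and being almost isometric requires `δ + 8 ≤ (1 - ξ) * M /
  -- 2`. With this `c`, both `δ` and `1` are at most `(1 - ξ) * M / 40`.
  obtain ⟨c, hc⟩ := exists_nat_ge (θ + 40 / (1 - ξ))
  have hc40 : (40 : ℝ) ≤ c * (1 - ξ) := by
    rw [← div_le_iff₀ hη]
    have : (0 : ℝ) ≤ θ := by positivity
    linarith
  have hc1 : 40 ≤ c := by
    have h1 : (40 : ℝ) ≤ c := hc40.trans (by nlinarith [(Nat.cast_nonneg c : (0 : ℝ) ≤ c)])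
    exact_mod_cast h1
  have hcθ : θ ≤ c := by
    have h1 : (θ : ℝ) ≤ c := le_trans (by have : 0 ≤ 40 / (1 - ξ) := by positivity
                                          linarith) hc
    exact_mod_cast h1
  refine ⟨c, fun N δ F hN hcδ hF hδ => ?_⟩
  have : NeZero N := ⟨by omega⟩
  have hδN : 40 * δ ≤ N := (Nat.mul_le_mul_right δ hc1).trans hcδ
  -- On one vertex all distances vanish, which forces a large `δ`. Otherwise every vertex has a
  -- neighbor, as needed to replace waits.
  have hnt : Nontrivial V := by
    by_contra hV
    rw [not_nontrivial_iff_subsingleton] at hV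
    have h1 := hδ 0 (N / 2) (by omega)
    rw [Subsingleton.elim (F (0 + (N / 2 : ℕ))) (F 0), dist_self] at h1
    omega
  have hnb : ∀ v, ∃ w, Γ.Adj v w := hΓ.preconnected.exists_adj_of_nontrivial
  obtain ⟨M, F', hM, hM1, hF', hδ', heven⟩ : ∃ (M : ℕ) (F' : ZMod M → V), N ≤ M ∧ M ≤ N + 1 ∧
      Γ.IsLazyCycle F' ∧ Γ.IsQuasiIsometric F' (δ + 2) ∧ Even (waits F' M) := by
    by_cases he : Even (waits F N)
    · exact ⟨N, F, le_rfl, by omega, hF, fun z k hk => (hδ z k hk).trans (by omega), he⟩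
    · refine ⟨N + 1, pad F, by omega, le_rfl, isLazyCycle_pad hF, isQuasiIsometric_pad hΓ hF hδ, ?_⟩
      rw [waits_pad, Nat.even_add_one]
      exact he
  have : NeZero M := ⟨by omega⟩
  obtain ⟨f, hf⟩ := exists_cycle_of_even_waits hnb hF' heven
  have := hθ M (by omega) f (f.isAlmostIsometric_of_isQuasiIsometric hΓ
    (isQuasiIsometric_of_dist_le_one hΓ hδ' hf) ?_)
  · omega
  · have h1 : (c : ℝ) * δ ≤ M := by exact_mod_cast hcδ.trans hM
    have h2 : (c : ℝ) ≤ M := by exact_mod_cast hN.le.trans hM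
    have h3 : 40 * (δ : ℝ) ≤ (1 - ξ) * M := by nlinarith [(Nat.cast_nonneg δ : (0 : ℝ) ≤ δ)]
    have h4 : (40 : ℝ) ≤ (1 - ξ) * M := by nlinarith
    push_cast
    linarith

end ShortcutGraph

/-! ### Potentials on trees -/

/-- Multiply the labels along the unique path from a root. Of the paths to two adjacent vertices,
one extends the other by their edge. -/
theorem SimpleGraph.IsTree.exists_potential {V : Type*} {H : SimpleGraph V} (hH : H.IsTree)
    {P : Type*} [Group P] (l : V → V → P) (hl : ∀ a b, H.Adj a b → l b a = (l a b)⁻¹) :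
    ∃ τ : V → P, ∀ a b, H.Adj a b → τ b = l a b * τ a := by
  obtain ⟨r⟩ := hH.connected.nonempty
  choose p hp using fun a => (hH.existsUnique_path r a).exists
  have key : ∀ a b, H.Adj a b → a ∈ (p b).support →
      ((p b).darts.map fun d => l d.fst d.snd).reverse.prod =
        l a b * ((p a).darts.map fun d => l d.fst d.snd).reverse.prod := by
    intro a b hab ha
    rw [hH.isAcyclic.path_concat (hp a) (hp b) hab ha, SimpleGraph.Walk.darts_concat]
    simp
  refine ⟨fun a => ((p a).darts.map fun d => l d.fst d.snd).reverse.prod, fun a b hab => ?_⟩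
  by_cases ha : a ∈ (p b).support
  · exact key a b hab ha
  · have hb := hH.isAcyclic.mem_support_of_ne_mem_support_of_adj_of_isPath (hp a) (hp b) hab ha
    dsimp only
    rw [key b a hab.symm hb, hl a b hab, mul_inv_cancel_left]

/-! ### Free actions of a finite group -/

/-- Under translations by `C`, the set `K` is a disjoint union of free orbits. As `C` is finite and
`K` infinite, both actions have as many orbits as `K` has elements. The cosets in use are left
cosets, for right translations; inversion turns these into left translations. -/
theorem exists_equiv_of_injective_of_finite {C : Type*} [Group C] [Finite C] {K : Type*} [Group K]
    [Infinite K] {α β : C →* K} (hα : Function.Injective α) (hβ : Function.Injective β) :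
    ∃ σ : Equiv.Perm K, ∀ h x, σ (α h * x) = β h * σ x := by
  have hcard : ∀ γ : C →* K, Cardinal.mk (K ⧸ γ.range) = Cardinal.mk K := by
    intro γ
    have e := Subgroup.groupEquivQuotientProdSubgroup (s := γ.range)
    have : Finite γ.range := Set.finite_range γ
    have hinf : Infinite (K ⧸ γ.range) := by
      by_contra hfin
      rw [not_infinite_iff_finite] at hfin
      exact not_finite_iff_infinite.2 ‹Infinite K› (Finite.of_equiv _ e.symm)
    rw [Cardinal.mk_congr e, Cardinal.mk_prod, Cardinal.lift_id, Cardinal.lift_id,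
      Cardinal.mul_eq_left (Cardinal.aleph0_le_mk _)
        ((Cardinal.mk_lt_aleph0).le.trans (Cardinal.aleph0_le_mk _)) (Cardinal.mk_ne_zero _)]
  have hF : ∀ γ : C →* K, Function.Injective γ →
      Function.Bijective fun z : (K ⧸ γ.range) × C => z.1.out * γ z.2 := by
    intro γ hγ
    refine ⟨?_, fun x => ?_⟩
    · rintro ⟨q, c⟩ ⟨q', c'⟩ h
      dsimp only at h
      have hq : q = q' := by
        have h1 : ((q.out * γ c : K) : K ⧸ γ.range) = q := by
          rw [QuotientGroup.mk_mul_of_mem _ (show γ c ∈ γ.range from ⟨c, rfl⟩), QuotientGroup.out_eq']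
        have h2 : ((q'.out * γ c' : K) : K ⧸ γ.range) = q' := by
          rw [QuotientGroup.mk_mul_of_mem _ (show γ c' ∈ γ.range from ⟨c', rfl⟩), QuotientGroup.out_eq']
        rw [← h1, ← h2, h]
      subst hq
      rw [hγ (mul_left_cancel h)]
    · obtain ⟨c, hc⟩ : (x : K ⧸ γ.range).out⁻¹ * x ∈ γ.range :=
        QuotientGroup.eq.1 (QuotientGroup.out_eq' _)
      exact ⟨(x, c), by simp [hc]⟩
  obtain ⟨ψ⟩ : Nonempty ((K ⧸ α.range) ≃ (K ⧸ β.range)) :=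
    Cardinal.eq.1 ((hcard α).trans (hcard β).symm)
  let Fα := Equiv.ofBijective _ (hF α hα)
  let Fβ := Equiv.ofBijective _ (hF β hβ)
  let σ := Fα.symm.trans ((ψ.prodCongr (Equiv.refl C)).trans Fβ)
  have hσ : ∀ x h, σ (x * α h) = σ x * β h := by
    intro x h
    obtain ⟨⟨q, c⟩, rfl⟩ := Fα.surjective x
    have e : Fα (q, c) * α h = Fα (q, c * h) := by
      simp [Fα, mul_assoc]
    rw [e]
    simp only [σ, Equiv.trans_apply, Equiv.symm_apply_apply]
    simp [Fβ, mul_assoc]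
  refine ⟨(Equiv.inv K).trans (σ.trans (Equiv.inv K)), fun h x => ?_⟩
  have := hσ x⁻¹ h⁻¹
  simp only [map_inv] at this
  simp [this]

/-! ### Splittings of groups: Bass–Serre theory in terms of cosets -/

namespace GraphOfGroups

variable {V : Type u} {E : Type v} (𝒢 : GraphOfGroups.{u, v, w, x} V E) {T : Set E}

variable {𝒢} in
-- This normalizes representations of the fundamental group: correcting by `τ` makes the stable
-- letters of the edges of `T` act trivially. Absence of loops and multiple edges in `T` makes the
-- labels `l` well defined.
theorem IsSpanningTree.exists_potential (hT : 𝒢.IsSpanningTree T) {P : Type*} [Group P]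
    (σ : E → P) : ∃ τ : V → P, ∀ e ∈ T, τ (𝒢.tgt e) = σ e * τ (𝒢.src e) := by
  classical
  obtain ⟨hloop, hinj, htree⟩ := hT
  let l : V → V → P := fun a b =>
    if h : ∃ e ∈ T, 𝒢.src e = a ∧ 𝒢.tgt e = b then σ h.choose
    else if h : ∃ e ∈ T, 𝒢.src e = b ∧ 𝒢.tgt e = a then (σ h.choose)⁻¹ else 1
  have hl : ∀ e ∈ T, l (𝒢.src e) (𝒢.tgt e) = σ e ∧ l (𝒢.tgt e) (𝒢.src e) = (σ e)⁻¹ := by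
    intro e he
    have h : ∃ e' ∈ T, 𝒢.src e' = 𝒢.src e ∧ 𝒢.tgt e' = 𝒢.tgt e := ⟨e, he, rfl, rfl⟩
    have h' : ¬ ∃ e' ∈ T, 𝒢.src e' = 𝒢.tgt e ∧ 𝒢.tgt e' = 𝒢.src e := by
      rintro ⟨e', he', h1, h2⟩
      have : e' = e := hinj he' he (by simp [h1, h2, Sym2.eq_swap])
      exact hloop e he (this ▸ h1)
    have hc : h.choose = e := hinj h.choose_spec.1 he (by
      dsimp only
      rw [h.choose_spec.2.1, h.choose_spec.2.2])
    constructor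
    · simp only [l, dif_pos h, hc]
    · simp only [l, dif_neg h', dif_pos h, hc]
  have hadj : ∀ a b, (SimpleGraph.fromRel fun a b => ∃ e ∈ T, 𝒢.src e = a ∧ 𝒢.tgt e = b).Adj a b →
      l b a = (l a b)⁻¹ := by
    rintro a b ⟨-, ⟨e, he, rfl, rfl⟩ | ⟨e, he, rfl, rfl⟩⟩
    · rw [(hl e he).1, (hl e he).2]
    · rw [(hl e he).1, (hl e he).2, inv_inv]
  obtain ⟨τ, hτ⟩ := htree.exists_potential l hadj
  refine ⟨τ, fun e he => ?_⟩
  rw [hτ (𝒢.src e) (𝒢.tgt e) ⟨hloop e he, Or.inl ⟨e, he, rfl, rfl⟩⟩, (hl e he).1]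

/-- A group `G` acting on a tree with quotient graph of groups `𝒢`, presented through the elements
of `G` instead of the tree: `side a g s` tells on which side of the edge `s` the vertex `g • a`
lies. -/
structure Splitting (G : Type y) [Group G] where
  incl : ∀ a, 𝒢.vertexGroup a →* G
  incl_injective : ∀ a, Function.Injective (incl a)
  stable : E → G
  stable_mul : ∀ e h, stable e * incl (𝒢.src e) (𝒢.srcHom e h) =
    incl (𝒢.tgt e) (𝒢.tgtHom e h) * stable e
  side : ∀ _ : V, G → (Σ e, G ⧸ ((incl (𝒢.tgt e)).comp (𝒢.tgtHom e)).range) → ZMod 2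
  side_mul : ∀ a g h, side a (g * incl a h) = side a g
  side_stable_of_ne : ∀ e g s, s ≠ ⟨e, (g : G ⧸ ((incl (𝒢.tgt e)).comp (𝒢.tgtHom e)).range)⟩ →
    side (𝒢.tgt e) g s = side (𝒢.src e) (g * stable e) s
  side_stable_ne : ∀ e g, side (𝒢.tgt e) g ⟨e, g⟩ ≠ side (𝒢.src e) (g * stable e) ⟨e, g⟩
  connected : ∀ κ : V → G → Prop, (∀ a g h, κ a g → κ a (g * incl a h)) →
    (∀ e g, κ (𝒢.tgt e) g ↔ κ (𝒢.src e) (g * stable e)) → ∀ a b g k, κ a g → κ b k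

/-! ### The fundamental group of a graph of groups and its splitting -/

namespace FundamentalGroup

variable (T)

/-- The map of a vertex group to the fundamental group. -/
def incl (a : V) : 𝒢.vertexGroup a →* 𝒢.FundamentalGroup T :=
  (QuotientGroup.mk' _).comp (𝒢.ofVertex a)

/-- The class of the stable letter of an edge. -/
def stable (e : E) : 𝒢.FundamentalGroup T :=
  QuotientGroup.mk' _ (𝒢.stableLetter e)

theorem stable_mul (e : E) (h : 𝒢.edgeGroup e) :
    stable 𝒢 T e * incl 𝒢 T (𝒢.src e) (𝒢.srcHom e h) =
      incl 𝒢 T (𝒢.tgt e) (𝒢.tgtHom e h) * stable 𝒢 T e := by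
  have h1 : 𝒢.stableLetter e * 𝒢.ofVertex (𝒢.src e) (𝒢.srcHom e h) * (𝒢.stableLetter e)⁻¹ *
        (𝒢.ofVertex (𝒢.tgt e) (𝒢.tgtHom e h))⁻¹ ∈ Subgroup.normalClosure (𝒢.relators T) :=
    Subgroup.subset_normalClosure (Or.inl ⟨e, h, rfl⟩)
  have h2 := (QuotientGroup.eq_one_iff _).2 h1
  have h3 : stable 𝒢 T e * incl 𝒢 T (𝒢.src e) (𝒢.srcHom e h) * (stable 𝒢 T e)⁻¹ *
      (incl 𝒢 T (𝒢.tgt e) (𝒢.tgtHom e h))⁻¹ = 1 := h2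
  rw [mul_inv_eq_one, mul_inv_eq_iff_eq_mul] at h3
  exact h3

theorem stable_eq_one {e : E} (he : e ∈ T) : stable 𝒢 T e = 1 :=
  (QuotientGroup.eq_one_iff _).2 (Subgroup.subset_normalClosure (Or.inr ⟨e, he, rfl⟩))

variable {T}

/-- The universal property of the fundamental group. -/
def lift {H : Type*} [Group H] (f : ∀ a, 𝒢.vertexGroup a →* H) (t : E → H)
    (hf : ∀ e h, t e * f (𝒢.src e) (𝒢.srcHom e h) = f (𝒢.tgt e) (𝒢.tgtHom e h) * t e)
    (ht : ∀ e ∈ T, t e = 1) : 𝒢.FundamentalGroup T →* H :=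
  QuotientGroup.lift _ (Monoid.Coprod.lift (Monoid.CoprodI.lift f) (FreeGroup.lift t)) <| by
    refine Subgroup.normalClosure_le_normal ?_
    rintro r (⟨e, h, rfl⟩ | ⟨e, he, rfl⟩)
    · simp [MonoidHom.mem_ker, stableLetter, ofVertex, hf]
    · simp [MonoidHom.mem_ker, stableLetter, ht e he]

@[simp]
theorem lift_incl {H : Type*} [Group H] (f : ∀ a, 𝒢.vertexGroup a →* H) (t : E → H)
    (hf : ∀ e h, t e * f (𝒢.src e) (𝒢.srcHom e h) = f (𝒢.tgt e) (𝒢.tgtHom e h) * t e)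
    (ht : ∀ e ∈ T, t e = 1) (a : V) (g : 𝒢.vertexGroup a) :
    lift 𝒢 f t hf ht (incl 𝒢 T a g) = f a g := by
  simp [lift, incl, ofVertex]

@[simp]
theorem lift_stable {H : Type*} [Group H] (f : ∀ a, 𝒢.vertexGroup a →* H) (t : E → H)
    (hf : ∀ e h, t e * f (𝒢.src e) (𝒢.srcHom e h) = f (𝒢.tgt e) (𝒢.tgtHom e h) * t e)
    (ht : ∀ e ∈ T, t e = 1) (e : E) : lift 𝒢 f t hf ht (stable 𝒢 T e) = t e := by
  simp [lift, stable, stableLetter]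

theorem mem_of_generators (K : Subgroup (𝒢.FundamentalGroup T)) (h1 : ∀ a g, incl 𝒢 T a g ∈ K)
    (h2 : ∀ e, stable 𝒢 T e ∈ K) (g : 𝒢.FundamentalGroup T) : g ∈ K := by
  obtain ⟨m, rfl⟩ := QuotientGroup.mk'_surjective _ g
  suffices m ∈ K.comap (QuotientGroup.mk' _) from this
  induction m using Monoid.Coprod.induction_on with
  | inl m =>
    induction m using Monoid.CoprodI.induction_on with
    | one => rw [map_one]; exact one_mem _
    | of a g => exact h1 a g
    | mul x y hx hy => rw [map_mul]; exact mul_mem hx hy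
  | inr m =>
    induction m using FreeGroup.induction_on with
    | C1 => rw [map_one]; exact one_mem _
    | of e => exact h2 e
    | inv_of e h => rw [map_inv]; exact inv_mem h
    | mul x y hx hy => rw [map_mul]; exact mul_mem hx hy
  | mul x y hx hy => exact mul_mem hx hy

theorem hom_ext {H : Type*} [Group H] {f f' : 𝒢.FundamentalGroup T →* H}
    (h1 : ∀ a g, f (incl 𝒢 T a g) = f' (incl 𝒢 T a g))
    (h2 : ∀ e, f (stable 𝒢 T e) = f' (stable 𝒢 T e)) : f = f' :=
  MonoidHom.ext fun g => mem_of_generators 𝒢 (f.eqLocus f') h1 h2 g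

/-- All vertex groups act faithfully by left translation on one infinite group `K`. The two actions
of an edge group are conjugate by a permutation, which serves as image of the stable letter, so a
representation of the fundamental group is faithful on every vertex group. -/
theorem incl_injective (hT : 𝒢.IsSpanningTree T) (hfin : ∀ e, Finite (𝒢.edgeGroup e)) (a : V) :
    Function.Injective (incl 𝒢 T a) := by
  classical
  -- The factor `ℤ` makes `K` infinite even if all vertex groups are finite.
  let K := (∀ a, 𝒢.vertexGroup a) × Multiplicative ℤ
  let j : ∀ a, 𝒢.vertexGroup a →* K := fun a =>
    (MonoidHom.inl _ _).comp (MonoidHom.mulSingle 𝒢.vertexGroup a)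
  have hj : ∀ a, Function.Injective (j a) := fun a g h hgh => by
    have := (Prod.ext_iff.1 hgh).1
    exact Pi.mulSingle_injective a this
  let L : K →* Equiv.Perm K := MulAction.toPermHom K K
  have hL : Function.Injective L := MulAction.toPerm_injective
  have : Infinite K := inferInstanceAs (Infinite ((∀ a, 𝒢.vertexGroup a) × Multiplicative ℤ))
  choose σ hσ using fun e => exists_equiv_of_injective_of_finite
    (α := (j (𝒢.src e)).comp (𝒢.srcHom e)) (β := (j (𝒢.tgt e)).comp (𝒢.tgtHom e))
    ((hj _).comp (𝒢.srcHom_injective e)) ((hj _).comp (𝒢.tgtHom_injective e))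
  have hσL : ∀ e h, σ e * L (j _ (𝒢.srcHom e h)) = L (j _ (𝒢.tgtHom e h)) * σ e :=
    fun e h => Equiv.ext fun y => hσ e h y
  obtain ⟨τ, hτ⟩ := hT.exists_potential σ
  let Ψ : 𝒢.FundamentalGroup T →* Equiv.Perm K := lift 𝒢
    (fun a => (MulAut.conj (τ a)⁻¹).toMonoidHom.comp (L.comp (j a)))
    (fun e => (τ (𝒢.tgt e))⁻¹ * σ e * τ (𝒢.src e))
    (fun e h => by
      simp only [MonoidHom.comp_apply, MulEquiv.coe_toMonoidHom, MulAut.conj_apply, inv_inv]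
      have := congrArg (fun z => (τ (𝒢.tgt e))⁻¹ * z * τ (𝒢.src e)) (hσL e h)
      simpa only [mul_assoc, mul_inv_cancel_left, inv_mul_cancel_left] using this)
    (fun e he => by
      rw [hτ e he, mul_inv_rev, mul_assoc, mul_assoc, inv_mul_eq_one, eq_inv_mul_iff_mul_eq])
  intro g h hgh
  have h1 := congrArg Ψ hgh
  simp only [Ψ, lift_incl, MonoidHom.comp_apply, MulEquiv.coe_toMonoidHom] at h1
  exact hj a (hL ((MulAut.conj (τ a)⁻¹).injective h1))

/-- The linear action on the functions on a family of coset spaces. -/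
def cosetFunctions {G : Type y} [Group G] (C : E → Subgroup G) :
    G →* Equiv.Perm ((Σ e, G ⧸ C e) → ZMod 2) where
  toFun g :=
    { toFun := fun m s => m ⟨s.1, g⁻¹ • s.2⟩
      invFun := fun m s => m ⟨s.1, g • s.2⟩
      left_inv := fun m => by simp
      right_inv := fun m => by simp }
  map_one' := by ext; simp
  map_mul' g h := by ext; simp [mul_smul]

theorem cosetFunctions_apply {G : Type y} [Group G] (C : E → Subgroup G) (g : G)
    (m : (Σ e, G ⧸ C e) → ZMod 2) (s : Σ e, G ⧸ C e) :
    cosetFunctions C g m s = m ⟨s.1, g⁻¹ • s.2⟩ := rfl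

theorem cosetFunctions_sub {G : Type y} [Group G] (C : E → Subgroup G) (g : G)
    (m m' : (Σ e, G ⧸ C e) → ZMod 2) :
    cosetFunctions C g (m - m') = cosetFunctions C g m - cosetFunctions C g m' := rfl

open Classical in
theorem cosetFunctions_single {G : Type y} [Group G] (C : E → Subgroup G) (g : G) (e : E)
    (s : Σ e, G ⧸ C e) :
    cosetFunctions C g (Pi.single ⟨e, ((1 : G) : G ⧸ C e)⟩ 1) s = if s = ⟨e, g⟩ then 1 else 0 := by
  rw [cosetFunctions_apply, Pi.single_apply]
  congr 1
  obtain ⟨e', q⟩ := s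
  simp only [Sigma.mk.injEq, eq_iff_iff]
  constructor
  · rintro ⟨rfl, h⟩
    refine ⟨rfl, ?_⟩
    rw [heq_iff_eq, inv_smul_eq_iff] at h
    rw [h, heq_iff_eq, MulAction.Quotient.smul_coe, smul_eq_mul, mul_one]
  · rintro ⟨rfl, h⟩
    refine ⟨rfl, ?_⟩
    rw [heq_iff_eq] at h
    rw [heq_iff_eq, inv_smul_eq_iff, h, MulAction.Quotient.smul_coe, smul_eq_mul, mul_one]

open Classical in
/-- The crossing cochain of the fundamental group. -/
theorem exists_side (hT : 𝒢.IsSpanningTree T) :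
    ∃ side : V → 𝒢.FundamentalGroup T →
        (Σ e, 𝒢.FundamentalGroup T ⧸ ((incl 𝒢 T (𝒢.tgt e)).comp (𝒢.tgtHom e)).range) → ZMod 2,
      (∀ a g h, side a (g * incl 𝒢 T a h) = side a g) ∧
      ∀ e g s, side (𝒢.tgt e) g s - side (𝒢.src e) (g * stable 𝒢 T e) s =
        if s = ⟨e, g⟩ then 1 else 0 := by
  let C : E → Subgroup (𝒢.FundamentalGroup T) :=
    fun e => ((incl 𝒢 T (𝒢.tgt e)).comp (𝒢.tgtHom e)).range
  let M := (Σ e, 𝒢.FundamentalGroup T ⧸ C e) → ZMod 2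
  let lin : 𝒢.FundamentalGroup T →* Equiv.Perm M := cosetFunctions C
  have hlin : ∀ g (m m' : M), lin g (m - m') = lin g m - lin g m' := cosetFunctions_sub C
  let pt : E → M := fun e => Pi.single ⟨e, ((1 : 𝒢.FundamentalGroup T) : _ ⧸ C e)⟩ 1
  have hpt : ∀ e h, lin (incl 𝒢 T _ (𝒢.tgtHom e h)) (pt e) = pt e := by
    intro e h
    ext s
    have h1 := cosetFunctions_single C (incl 𝒢 T _ (𝒢.tgtHom e h)) e s
    have h2 := cosetFunctions_single C 1 e s
    have h3 : ((incl 𝒢 T _ (𝒢.tgtHom e h) : 𝒢.FundamentalGroup T) : 𝒢.FundamentalGroup T ⧸ C e) =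
        ((1 : 𝒢.FundamentalGroup T) : 𝒢.FundamentalGroup T ⧸ C e) := by
      rw [eq_comm, QuotientGroup.eq, inv_one, one_mul]
      exact ⟨h, rfl⟩
    rw [h3] at h1
    rw [map_one] at h2
    exact h1.trans h2.symm
  -- The point `γ a` will be the image of the base lift of the vertex `a`. Across an edge of `T` it
  -- has to change by the indicator `pt e` of the base lift of `e`.
  obtain ⟨γ', hγ'⟩ := hT.exists_potential (fun e => Multiplicative.ofAdd (pt e))
  let γ : V → M := fun a => (γ' a).toAdd
  have hγ : ∀ e ∈ T, γ (𝒢.tgt e) = pt e + γ (𝒢.src e) := fun e he => by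
    simp only [γ, hγ' e he, toAdd_mul, toAdd_ofAdd]
  let tr : M → Equiv.Perm M := Equiv.addLeft
  have htr : ∀ m m', tr m m' = m + m' := fun _ _ => rfl
  have htr' : ∀ m m', (tr m)⁻¹ m' = m' - m := fun m m' => by
    rw [Equiv.Perm.inv_eq_iff_eq, htr]; abel
  -- Affine action with linear part `lin`: the group of `a` fixes `γ a`, and the stable letter of
  -- `e` sends `γ (src e)` to `γ (tgt e) - pt e`. The edge relations hold since the edge group fixes
  -- `pt e`; the choice of `γ` makes the letters of `T` trivial.
  let Φ : 𝒢.FundamentalGroup T →* Equiv.Perm M := lift 𝒢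
    (fun a => (MulAut.conj (tr (γ a))).toMonoidHom.comp (lin.comp (incl 𝒢 T a)))
    (fun e => tr (γ (𝒢.tgt e) - pt e) * lin (stable 𝒢 T e) * (tr (γ (𝒢.src e)))⁻¹)
    (fun e h => by
      ext1 m
      simp only [MonoidHom.comp_apply, MulEquiv.coe_toMonoidHom, MulAut.conj_apply,
        Equiv.Perm.mul_apply, htr, htr']
      have h1 : ∀ m, lin (stable 𝒢 T e) (lin (incl 𝒢 T _ (𝒢.srcHom e h)) m) =
          lin (incl 𝒢 T _ (𝒢.tgtHom e h)) (lin (stable 𝒢 T e) m) := fun m => by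
        rw [← Equiv.Perm.mul_apply, ← map_mul, stable_mul, map_mul, Equiv.Perm.mul_apply]
      rw [add_sub_cancel_left, h1]
      have h2 : γ (𝒢.tgt e) - pt e + lin (stable 𝒢 T e) (m - γ (𝒢.src e)) - γ (𝒢.tgt e) =
          lin (stable 𝒢 T e) (m - γ (𝒢.src e)) - pt e := by abel
      rw [h2, hlin _ _ (pt e), hpt]
      abel)
    (fun e he => by
      ext1 m
      simp only [stable_eq_one 𝒢 T he, map_one, mul_one, Equiv.Perm.mul_apply, htr, htr',
        hγ e he, Equiv.Perm.one_apply]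
      abel)
  have hΦi : ∀ a g m, Φ (incl 𝒢 T a g) m = γ a + lin (incl 𝒢 T a g) (m - γ a) := fun a g m => by
    simp only [Φ, lift_incl, MonoidHom.comp_apply, MulEquiv.coe_toMonoidHom, MulAut.conj_apply,
        Equiv.Perm.mul_apply, htr, htr']
  have hΦs : ∀ e m, Φ (stable 𝒢 T e) m =
      γ (𝒢.tgt e) - pt e + lin (stable 𝒢 T e) (m - γ (𝒢.src e)) := fun e m => by
    simp only [Φ, lift_stable, Equiv.Perm.mul_apply, htr, htr']
  have hlin0 : ∀ g, lin g 0 = 0 := fun g => rfl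
  let Kaff : Subgroup (𝒢.FundamentalGroup T) :=
    { carrier := {g | ∀ m m', Φ g m - Φ g m' = lin g (m - m')}
      one_mem' := fun m m' => by simp
      mul_mem' := fun {g h} hg hh m m' => by
        rw [map_mul, map_mul, Equiv.Perm.mul_apply, Equiv.Perm.mul_apply, hg, hh,
          Equiv.Perm.mul_apply]
      inv_mem' := fun {g} hg m m' => by
        have h1 := hg (Φ g⁻¹ m) (Φ g⁻¹ m')
        rw [← Equiv.Perm.mul_apply, ← Equiv.Perm.mul_apply, ← map_mul, mul_inv_cancel, map_one,
          Equiv.Perm.one_apply, Equiv.Perm.one_apply] at h1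
        rw [h1, ← Equiv.Perm.mul_apply, ← map_mul, inv_mul_cancel, map_one, Equiv.Perm.one_apply] }
  have haff : ∀ g m m', Φ g m - Φ g m' = lin g (m - m') := fun g => by
    refine mem_of_generators 𝒢 Kaff (fun a g m m' => ?_) (fun e m m' => ?_) g
    · rw [hΦi, hΦi, add_sub_add_left_eq_sub, ← hlin, sub_sub_sub_cancel_right]
    · rw [hΦs, hΦs, add_sub_add_left_eq_sub, ← hlin, sub_sub_sub_cancel_right]
  -- The orbit map of the affine action: it is constant on cosets of vertex groups because they fix
  -- `γ a`, and its jump across the translate by `g` of an edge is `lin g (pt e)`.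
  refine ⟨fun a g => Φ g (γ a), fun a g h => ?_, fun e g s => ?_⟩
  · dsimp only
    rw [map_mul, Equiv.Perm.mul_apply, hΦi, sub_self, hlin0, add_zero]
  · have h1 : Φ g (γ (𝒢.tgt e)) - Φ (g * stable 𝒢 T e) (γ (𝒢.src e)) = lin g (pt e) := by
      rw [map_mul, Equiv.Perm.mul_apply, hΦs, sub_self, hlin0, add_zero, haff, sub_sub_cancel]
    exact (congrFun h1 s).trans (cosetFunctions_single C g e s)

/-- The letters of `T` being trivial, `κ a g` does not depend on `a`. The right translations
preserving it form a subgroup that contains all generators. -/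
theorem connected (hT : 𝒢.IsSpanningTree T) (κ : V → 𝒢.FundamentalGroup T → Prop)
    (h1 : ∀ a g h, κ a g → κ a (g * incl 𝒢 T a h))
    (h2 : ∀ e g, κ (𝒢.tgt e) g ↔ κ (𝒢.src e) (g * stable 𝒢 T e)) (a b : V)
    (g k : 𝒢.FundamentalGroup T) (hκ : κ a g) : κ b k := by
  have h1' : ∀ a g h, κ a (g * incl 𝒢 T a h) ↔ κ a g := fun a g h =>
    ⟨fun h' => by simpa [mul_assoc, ← map_mul] using h1 a _ h⁻¹ h', h1 a g h⟩
  have hV : ∀ g a b, κ a g ↔ κ b g := by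
    intro g a b
    obtain ⟨p⟩ := hT.2.2.connected.preconnected a b
    induction p with
    | nil => rfl
    | cons hadj _ ih =>
      rw [← ih]
      rcases hadj with ⟨-, ⟨e, he, rfl, rfl⟩ | ⟨e, he, rfl, rfl⟩⟩
      · rw [h2, stable_eq_one 𝒢 T he, mul_one]
      · rw [h2, stable_eq_one 𝒢 T he, mul_one]
  let K : Subgroup (𝒢.FundamentalGroup T) :=
    { carrier := {k | ∀ g, κ a (g * k) ↔ κ a g}
      one_mem' := fun g => by rw [mul_one]
      mul_mem' := fun {x y} hx hy g => by rw [← mul_assoc, hy, hx]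
      inv_mem' := fun {x} hx g => by rw [← hx, inv_mul_cancel_right] }
  have hK := mem_of_generators 𝒢 K (fun b h g => by rw [hV _ a b, h1', hV _ b a])
    (fun e g => by rw [hV _ a (𝒢.src e), ← h2, hV _ _ a])
  rw [hV k b a, ← mul_inv_cancel_left g k]
  exact (hK (g⁻¹ * k) g).2 hκ

/-- The fundamental group of a graph of groups with finite edge groups splits. -/
theorem nonempty_splitting (hT : 𝒢.IsSpanningTree T) (hfin : ∀ e, Finite (𝒢.edgeGroup e)) :
    Nonempty (𝒢.Splitting (𝒢.FundamentalGroup T)) := by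
  classical
  obtain ⟨side, hs1, hs2⟩ := exists_side 𝒢 hT
  exact ⟨{
    incl := incl 𝒢 T
    incl_injective := incl_injective 𝒢 hT hfin
    stable := stable 𝒢 T
    stable_mul := stable_mul 𝒢 T
    side := side
    side_mul := hs1
    side_stable_of_ne := fun e g s hs => by
      have := hs2 e g s
      rwa [if_neg hs, sub_eq_zero] at this
    side_stable_ne := fun e g => by
      have := hs2 e g ⟨e, g⟩
      rw [if_pos rfl] at this
      intro h
      rw [h, sub_self] at this
      exact zero_ne_one this
    connected := connected 𝒢 hT }⟩

end FundamentalGroup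

end GraphOfGroups

/-! ### The tree of spaces of a splitting -/

namespace GraphOfGroups

open SimpleGraph

variable {V : Type u} {E : Type v} {𝒢 : GraphOfGroups.{u, v, w, x} V E} {G : Type y} [Group G]

namespace Splitting

variable (Sp : 𝒢.Splitting G)

/-- The image of an edge group at the end of the edge. -/
abbrev edgeSubgroup (e : E) : Subgroup G :=
  ((Sp.incl (𝒢.tgt e)).comp (𝒢.tgtHom e)).range

/-- The edges of the tree. -/
abbrev Star : Type (max v y) :=
  Σ e, G ⧸ Sp.edgeSubgroup e

/-- The vertices of the two ends of an edge. -/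
def vert (𝒢 : GraphOfGroups.{u, v, w, x} V E) (e : E) : Bool → V
  | true => 𝒢.tgt e
  | false => 𝒢.src e

/-- The two homomorphisms of an edge group. -/
def endHom (𝒢 : GraphOfGroups.{u, v, w, x} V E) (e : E) :
    ∀ σ, 𝒢.edgeGroup e →* 𝒢.vertexGroup (vert 𝒢 e σ)
  | true => 𝒢.tgtHom e
  | false => 𝒢.srcHom e

/-- The position of the two ends of the base lift of an edge. -/
def arm (e : E) : Bool → G
  | true => 1
  | false => Sp.stable e

theorem incl_mul_arm (e : E) (σ : Bool) (h : 𝒢.edgeGroup e) :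
    Sp.incl _ (𝒢.tgtHom e h) * Sp.arm e σ = Sp.arm e σ * Sp.incl _ (endHom 𝒢 e σ h) := by
  cases σ
  · exact (Sp.stable_mul e h).symm
  · exact (mul_one _).trans (one_mul _).symm

/-- Representatives of one coset differ by an element of the edge group. Moving it across the arm
turns it into an element of the vertex group, so both representatives lead to the same piece at each
end. -/
theorem exists_of_coset_eq {e : E} {k k' : G} (h : (k : G ⧸ Sp.edgeSubgroup e) = k') (σ : Bool) :
    ∃ c, k' * Sp.arm e σ = k * Sp.arm e σ * Sp.incl _ (endHom 𝒢 e σ c) := by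
  obtain ⟨c, hc⟩ := QuotientGroup.eq.1 h
  refine ⟨c, ?_⟩
  rw [mul_assoc, ← incl_mul_arm, ← mul_assoc]
  congr 1
  rw [MonoidHom.comp_apply] at hc
  rw [hc, mul_inv_cancel_left]

theorem side_arm_eq {e : E} {k k' : G} (h : (k : G ⧸ Sp.edgeSubgroup e) = k') (σ : Bool) :
    Sp.side (vert 𝒢 e σ) (k' * Sp.arm e σ) = Sp.side (vert 𝒢 e σ) (k * Sp.arm e σ) := by
  obtain ⟨c, hc⟩ := Sp.exists_of_coset_eq h σ
  rw [hc, Sp.side_mul]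

theorem side_arm_of_ne {e : E} {k : G} {s : Sp.Star} (hs : s ≠ ⟨e, k⟩) (σ : Bool) :
    Sp.side (vert 𝒢 e σ) (k * Sp.arm e σ) s = Sp.side (𝒢.src e) (k * Sp.stable e) s := by
  cases σ
  · rfl
  · have := Sp.side_stable_of_ne e k s hs
    simpa [arm, vert] using this

theorem side_arm_ne {e : E} {k : G} {σ σ' : Bool} (hσ : σ ≠ σ') :
    Sp.side (vert 𝒢 e σ) (k * Sp.arm e σ) ⟨e, k⟩ ≠
      Sp.side (vert 𝒢 e σ') (k * Sp.arm e σ') ⟨e, k⟩ := by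
  have := Sp.side_stable_ne e k
  cases σ <;> cases σ'
  · exact absurd rfl hσ
  · simpa [arm, vert] using this.symm
  · simpa [arm, vert] using this
  · exact absurd rfl hσ

variable (A : V → Type z) [∀ a, MulAction (𝒢.vertexGroup a) (A a)]

/-- The relation identifying `(g * h, v)` with `(g, h • v)` for `h` in the vertex group. -/
def pieceSetoid (a : V) : Setoid (G × A a) where
  r s t := ∃ h : 𝒢.vertexGroup a, s.1 = t.1 * Sp.incl a h ∧ t.2 = h • s.2
  iseqv :=
    { refl := fun s => ⟨1, by simp, by simp⟩
      symm := by
        rintro s t ⟨h, h1, h2⟩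
        exact ⟨h⁻¹, by simp [h1], by simp [h2]⟩
      trans := by
        rintro s t r ⟨h, h1, h2⟩ ⟨k, k1, k2⟩
        exact ⟨k * h, by simp [h1, k1, mul_assoc], by simp [h2, k2, mul_smul]⟩ }

/-- The vertices of all the translates of the space attached to a vertex. -/
def PieceVertex (a : V) : Type (max y z) :=
  Quotient (Sp.pieceSetoid A a)

variable {A}

/-- The translate by `g` of a vertex of the space attached to `a`. -/
def pieceMk (a : V) (g : G) (v : A a) : Sp.PieceVertex A a :=
  Quotient.mk (Sp.pieceSetoid A a) (g, v)

theorem pieceMk_eq {a : V} {g g' : G} {v v' : A a} :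
    Sp.pieceMk a g v = Sp.pieceMk a g' v' ↔ ∃ h, g = g' * Sp.incl a h ∧ v' = h • v :=
  Quotient.eq (r := Sp.pieceSetoid A a)

theorem pieceMk_mul (a : V) (g : G) (h : 𝒢.vertexGroup a) (v : A a) :
    Sp.pieceMk a (g * Sp.incl a h) v = Sp.pieceMk a g (h • v) :=
  Sp.pieceMk_eq.2 ⟨h, rfl, rfl⟩

theorem pieceMk_injective (a : V) (g : G) : Function.Injective (Sp.pieceMk a g : A a → _) := by
  intro v v' h
  obtain ⟨k, hk, hv⟩ := Sp.pieceMk_eq.1 h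
  have : Sp.incl a k = Sp.incl a 1 := by
    rw [map_one]
    exact (mul_eq_left.1 hk.symm)
  rw [Sp.incl_injective a this, one_smul] at hv
  exact hv.symm

theorem PieceVertex.ind {a : V} {motive : Sp.PieceVertex A a → Prop}
    (h : ∀ g v, motive (Sp.pieceMk a g v)) (x : Sp.PieceVertex A a) : motive x :=
  Quotient.ind (fun z => h z.1 z.2) x

instance (a : V) : MulAction G (Sp.PieceVertex A a) where
  smul k := Quotient.map (fun z => (k * z.1, z.2)) (by
    rintro s t ⟨h, h1, h2⟩
    exact ⟨h, by simp [h1, mul_assoc], h2⟩)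
  one_smul x := by
    induction x using PieceVertex.ind with
    | h g v => exact congrArg (fun g => Sp.pieceMk a g v) (one_mul g)
  mul_smul k l x := by
    induction x using PieceVertex.ind with
    | h g v => exact congrArg (fun g => Sp.pieceMk a g v) (mul_assoc k l g)

theorem smul_pieceMk (a : V) (k g : G) (v : A a) : k • Sp.pieceMk a g v = Sp.pieceMk a (k * g) v := rfl

variable (A) in
/-- The vertices of the tree of spaces: those of the pieces, those in the interior of the legs and
the centers of the stars. -/
inductive Vertex (K : ℕ) : Type (max u v y z)
  | piece (a : V) (x : Sp.PieceVertex A a) : Vertex K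
  -- Legs are indexed by elements of `G`, so they are permuted freely; stars are indexed by cosets,
  -- so all legs of one coset, at both ends, meet in one center.
  | leg (e : E) (σ : Bool) (g : G) (j : Fin (K + 1)) : Vertex K
  | star (s : Sp.Star) : Vertex K

variable {K : ℕ}

instance : MulAction G (Sp.Vertex A K) where
  smul k
    | .piece a x => .piece a (k • x)
    | .leg e σ g j => .leg e σ (k * g) j
    | .star s => .star ⟨s.1, k • s.2⟩
  one_smul x := by
    cases x with
    | piece a x => exact congrArg (Vertex.piece a) (one_smul G x)
    | leg e σ g j => exact congrArg (fun g => Vertex.leg e σ g j) (one_mul g)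
    | star s => exact congrArg (fun q => Vertex.star ⟨s.1, q⟩) (one_smul G s.2)
  mul_smul k l x := by
    cases x with
    | piece a x => exact congrArg (Vertex.piece a) (mul_smul k l x)
    | leg e σ g j => exact congrArg (fun g => Vertex.leg e σ g j) (mul_assoc k l g)
    | star s => exact congrArg (fun q => Vertex.star ⟨s.1, q⟩) (mul_smul k l s.2)

theorem smul_piece (k : G) (a : V) (x : Sp.PieceVertex A a) :
    k • (Vertex.piece a x : Sp.Vertex A K) = .piece a (k • x) := rfl

theorem smul_leg (k : G) (e : E) (σ : Bool) (g : G) (j : Fin (K + 1)) :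
    k • (Vertex.leg e σ g j : Sp.Vertex A K) = .leg e σ (k * g) j := rfl

theorem smul_star (k : G) (s : Sp.Star) :
    k • (Vertex.star s : Sp.Vertex A K) = .star ⟨s.1, k • s.2⟩ := rfl

variable (p : ∀ a, A a)

/-- The vertex of a piece to which a leg is attached. -/
def foot (e : E) (σ : Bool) (g : G) : Sp.Vertex A K :=
  .piece (vert 𝒢 e σ) (Sp.pieceMk _ (g * Sp.arm e σ) (p _))

theorem smul_foot (k : G) (e : E) (σ : Bool) (g : G) :
    k • (Sp.foot p e σ g : Sp.Vertex A K) = Sp.foot p e σ (k * g) := by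
  rw [foot, smul_piece, smul_pieceMk, foot, mul_assoc]

variable (Γ : ∀ a, SimpleGraph (A a))

/-- The oriented edges of the tree of spaces. -/
inductive Link : Sp.Vertex A K → Sp.Vertex A K → Prop
  | inner (a : V) (g : G) (v v' : A a) (h : (Γ a).Adj v v') :
      Link (.piece a (Sp.pieceMk a g v)) (.piece a (Sp.pieceMk a g v'))
  | foot (e : E) (σ : Bool) (g : G) : Link (Sp.foot p e σ g) (.leg e σ g 0)
  | step (e : E) (σ : Bool) (g : G) (i j : Fin (K + 1)) (h : (i : ℕ) + 1 = j) :
      Link (.leg e σ g i) (.leg e σ g j)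
  | top (e : E) (σ : Bool) (g : G) : Link (.leg e σ g (Fin.last K)) (.star ⟨e, g⟩)

variable (K) in
/-- The tree of spaces: the translates of the spaces attached to the vertices, and for each coset
of an edge group a star whose legs end at the translates of the base points. -/
def treeOfSpaces : SimpleGraph (Sp.Vertex A K) :=
  SimpleGraph.fromRel (Sp.Link p Γ)

variable {p Γ}

theorem Link.smul (k : G) {a b : Sp.Vertex A K} (h : Sp.Link p Γ a b) :
    Sp.Link p Γ (k • a) (k • b) := by
  cases h with
  | inner a g v v' h => exact .inner a (k * g) v v' h
  | foot e σ g =>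
    rw [smul_foot]
    exact .foot e σ (k * g)
  | step e σ g i j h => exact .step e σ (k * g) i j h
  | top e σ g => exact .top e σ (k * g)

theorem Link.ne {a b : Sp.Vertex A K} (h : Sp.Link p Γ a b) : a ≠ b := by
  cases h with
  | inner a g v v' h =>
    intro h'
    exact h.ne (Sp.pieceMk_injective a g (Vertex.piece.inj h' |>.2 |> eq_of_heq))
  | foot e σ g =>
    intro h
    rw [Splitting.foot] at h
    cases h
  | step e σ g i j h =>
    intro h'
    have := (Vertex.leg.inj h').2.2.2
    rw [this] at h
    omega
  | top e σ g => exact fun h => by cases h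

theorem Link.adj {a b : Sp.Vertex A K} (h : Sp.Link p Γ a b) : (Sp.treeOfSpaces K p Γ).Adj a b :=
  ⟨h.ne, Or.inl h⟩

theorem adj_smul (k : G) {a b : Sp.Vertex A K} (h : (Sp.treeOfSpaces K p Γ).Adj a b) :
    (Sp.treeOfSpaces K p Γ).Adj (k • a) (k • b) :=
  ⟨fun h' => h.1 (MulAction.injective k h'), h.2.imp (Link.smul Sp k) (Link.smul Sp k)⟩

/-! ### Connectedness -/

theorem reachable_piece (hΓ : ∀ a, (Γ a).Connected) (a : V) (g : G) (v v' : A a) :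
    (Sp.treeOfSpaces K p Γ).Reachable (.piece a (Sp.pieceMk a g v)) (.piece a (Sp.pieceMk a g v')) := by
  let φ : Γ a →g Sp.treeOfSpaces K p Γ :=
    ⟨fun v => .piece a (Sp.pieceMk a g v), fun h => (Link.inner a g _ _ h).adj⟩
  exact ((hΓ a).preconnected v v').map φ

theorem exists_walk_leg_star (e : E) (σ : Bool) (g : G) (n : ℕ) :
    ∀ j : Fin (K + 1), (j : ℕ) + n = K →
      ∃ q : (Sp.treeOfSpaces K p Γ).Walk (.leg e σ g j) (.star ⟨e, g⟩), q.length = n + 1 := by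
  induction n with
  | zero =>
    intro j hj
    have : j = Fin.last K := Fin.ext (by simpa using hj)
    subst this
    exact ⟨(Link.top e σ g).adj.toWalk, rfl⟩
  | succ n ih =>
    intro j hj
    obtain ⟨q, hq⟩ := ih ⟨j + 1, by omega⟩ (by simp only; omega)
    exact ⟨.cons (Link.step e σ g j ⟨j + 1, by omega⟩ rfl).adj q, by simp [hq]⟩

theorem dist_leg_star_le (e : E) (σ : Bool) (g : G) (j : Fin (K + 1)) :
    (Sp.treeOfSpaces K p Γ).dist (.leg e σ g j) (.star ⟨e, g⟩) ≤ K + 1 := by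
  obtain ⟨q, hq⟩ := Sp.exists_walk_leg_star (p := p) (Γ := Γ) e σ g (K - j) j (by omega)
  have := dist_le q
  omega

theorem reachable_leg_star (e : E) (σ : Bool) (g : G) (j : Fin (K + 1)) :
    (Sp.treeOfSpaces K p Γ).Reachable (.leg e σ g j) (.star ⟨e, g⟩) := by
  obtain ⟨q, -⟩ := Sp.exists_walk_leg_star (p := p) (Γ := Γ) e σ g (K - j) j (by omega)
  exact ⟨q⟩

theorem reachable_foot_star (e : E) (σ : Bool) (g : G) :
    (Sp.treeOfSpaces K p Γ).Reachable (Sp.foot p e σ g) (.star ⟨e, g⟩) :=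
  (Link.foot e σ g).adj.reachable.trans (Sp.reachable_leg_star e σ g 0)

theorem dist_foot_star_le (e : E) (σ : Bool) (g : G) :
    (Sp.treeOfSpaces K p Γ).dist (Sp.foot p e σ g) (.star ⟨e, g⟩) ≤ K + 2 := by
  obtain ⟨q, hq⟩ := Sp.exists_walk_leg_star (p := p) (Γ := Γ) e σ g K (0 : Fin (K + 1)) (by simp)
  have := dist_le (Walk.cons (Link.foot e σ g).adj q)
  rw [Walk.length_cons] at this
  omega

theorem connected_treeOfSpaces [Nonempty V] (hΓ : ∀ a, (Γ a).Connected) :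
    (Sp.treeOfSpaces K p Γ).Connected := by
  obtain ⟨a₀⟩ := ‹Nonempty V›
  let x₀ : Sp.Vertex A K := .piece a₀ (Sp.pieceMk a₀ 1 (p a₀))
  have hpiece : ∀ a g (v : A a), (Sp.treeOfSpaces K p Γ).Reachable x₀ (.piece a (Sp.pieceMk a g v)) := by
    intro a g
    -- The property propagated is that a whole translate is reachable. It is equivalent at the two
    -- ends of an edge because both are joined to the same star.
    refine Sp.connected
      (fun a g => ∀ v : A a, (Sp.treeOfSpaces K p Γ).Reachable x₀ (.piece a (Sp.pieceMk a g v)))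
      (fun a g h hg v => ?_) (fun e g => ?_) a₀ a 1 g (Sp.reachable_piece hΓ a₀ 1 _)
    · rw [pieceMk_mul]
      exact hg _
    · have key : ∀ σ, (∀ v : A (vert 𝒢 e σ), (Sp.treeOfSpaces K p Γ).Reachable x₀
          (.piece _ (Sp.pieceMk _ (g * Sp.arm e σ) v))) ↔
          (Sp.treeOfSpaces K p Γ).Reachable x₀ (.star ⟨e, g⟩) := fun σ =>
        ⟨fun h => (h (p _)).trans (Sp.reachable_foot_star e σ g), fun h v =>
          (h.trans (Sp.reachable_foot_star e σ g).symm).trans (Sp.reachable_piece hΓ _ _ _ _)⟩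
      have h1 := key true
      have h2 := key false
      simp only [arm, mul_one] at h1 h2
      exact h1.trans h2.symm
  have hall : ∀ y, (Sp.treeOfSpaces K p Γ).Reachable x₀ y := by
    intro y
    cases y with
    | piece a x =>
      induction x using PieceVertex.ind with
      | h g v => exact hpiece a g v
    | leg e σ g j =>
      exact ((hpiece _ _ _).trans (Sp.reachable_foot_star e σ g)).trans
        (Sp.reachable_leg_star e σ g j).symm
    | star s =>
      obtain ⟨e, q⟩ := s
      obtain ⟨g, rfl⟩ := QuotientGroup.mk_surjective q
      exact (hpiece _ _ _).trans (Sp.reachable_foot_star e true g)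
  have : Nonempty (Sp.Vertex A K) := ⟨x₀⟩
  exact ⟨fun y y' => (hall y).symm.trans (hall y')⟩

/-! ### The action -/

open ShortcutGraph in
theorem isProperCocompactAction_treeOfSpaces [Finite V] [Finite E]
    (hfin : ∀ e, Finite (𝒢.edgeGroup e))
    (hact : ∀ a, IsProperCocompactAction (𝒢.vertexGroup a) (Γ a)) :
    IsProperCocompactAction G (Sp.treeOfSpaces K p Γ) where
  adj_smul k a b := Sp.adj_smul k
  finite_stabilizer y := by
    cases y with
    | piece a x =>
      induction x using PieceVertex.ind with
      | h g v =>
        have := (hact a).finite_stabilizer v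
        refine Set.Finite.subset (Set.finite_range
          fun h : MulAction.stabilizer (𝒢.vertexGroup a) v => g * Sp.incl a h * g⁻¹) fun k hk => ?_
        have h1 : Sp.pieceMk a (k * g) v = Sp.pieceMk a g v :=
          eq_of_heq (Vertex.piece.inj (MulAction.mem_stabilizer_iff.1 hk)).2
        obtain ⟨h, h2, h3⟩ := Sp.pieceMk_eq.1 h1
        exact ⟨⟨h, h3.symm⟩, by simp [← h2]⟩
    | leg e σ g j =>
      refine Set.Finite.subset (Set.finite_singleton (1 : G)) fun k hk => ?_
      have h1 : k * g = g := (Vertex.leg.inj (MulAction.mem_stabilizer_iff.1 hk)).2.2.1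
      simpa using h1
    | star s =>
      obtain ⟨e, q⟩ := s
      obtain ⟨g, rfl⟩ := QuotientGroup.mk_surjective q
      refine Set.Finite.subset (Set.finite_range
        fun h : 𝒢.edgeGroup e => g * Sp.incl _ (𝒢.tgtHom e h) * g⁻¹) fun k hk => ?_
      have h1 : ((k * g : G) : G ⧸ Sp.edgeSubgroup e) = g :=
        eq_of_heq (Sigma.mk.inj (Vertex.star.inj (MulAction.mem_stabilizer_iff.1 hk))).2
      obtain ⟨h, h2⟩ := QuotientGroup.eq.1 h1.symm
      refine ⟨h, ?_⟩
      rw [MonoidHom.comp_apply] at h2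
      simp only [h2]
      group
  finite_vertex_orbits := by
    have := fun a => (hact a).finite_vertex_orbits
    let f : ((Σ a, MulAction.orbitRel.Quotient (𝒢.vertexGroup a) (A a)) ⊕
        (E × Bool × Fin (K + 1))) ⊕ E → MulAction.orbitRel.Quotient G (Sp.Vertex A K)
      | .inl (.inl ⟨a, q⟩) => Quotient.mk'' (.piece a (Sp.pieceMk a 1 q.out))
      | .inl (.inr ⟨e, σ, j⟩) => Quotient.mk'' (.leg e σ 1 j)
      | .inr e => Quotient.mk'' (.star ⟨e, ((1 : G) : G ⧸ Sp.edgeSubgroup e)⟩)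
    refine Finite.of_surjective f fun y => ?_
    induction y using Quotient.inductionOn' with
    | h y =>
    cases y with
    | piece a x =>
      induction x using PieceVertex.ind with
      | h g v =>
        let q : MulAction.orbitRel.Quotient (𝒢.vertexGroup a) (A a) := Quotient.mk'' v
        obtain ⟨h, hh⟩ : v ∈ MulAction.orbit (𝒢.vertexGroup a) q.out := by
          rw [← MulAction.orbitRel_apply]
          exact Quotient.exact' (Quotient.out_eq' q).symm
        refine ⟨.inl (.inl ⟨a, q⟩), Quotient.sound' ?_⟩
        refine (MulAction.orbitRel G (Sp.Vertex A K)).symm ?_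
        refine ⟨g * Sp.incl a h, ?_⟩
        change Vertex.piece a (Sp.pieceMk a (g * Sp.incl a h * 1) q.out) = _
        rw [mul_one, pieceMk_mul]
        exact congrArg (fun v => Vertex.piece a (Sp.pieceMk a g v)) hh
    | leg e σ g j =>
      refine ⟨.inl (.inr ⟨e, σ, j⟩), Quotient.sound' ?_⟩
      refine (MulAction.orbitRel G (Sp.Vertex A K)).symm ⟨g, ?_⟩
      exact congrArg (fun g => Vertex.leg e σ g j) (mul_one g)
    | star s =>
      obtain ⟨e, q⟩ := s
      obtain ⟨g, rfl⟩ := QuotientGroup.mk_surjective q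
      refine ⟨.inr e, Quotient.sound' ?_⟩
      refine (MulAction.orbitRel G (Sp.Vertex A K)).symm ⟨g, ?_⟩
      exact congrArg (fun g : G => Vertex.star ⟨e, (g : G ⧸ Sp.edgeSubgroup e)⟩) (mul_one g)
  finite_edge_orbits := by
    choose S hS hS' using fun a => (hact a).finite_edge_orbits
    let S₀ : Set (Sp.Vertex A K × Sp.Vertex A K) :=
      (⋃ a, (fun z : A a × A a => (.piece a (Sp.pieceMk a 1 z.1), .piece a (Sp.pieceMk a 1 z.2))) '' S a) ∪
      Set.range (fun z : E × Bool => (Sp.foot p z.1 z.2 1, .leg z.1 z.2 1 0)) ∪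
      Set.range (fun z : E × Bool × Fin (K + 1) × Fin (K + 1) =>
        (.leg z.1 z.2.1 1 z.2.2.1, .leg z.1 z.2.1 1 z.2.2.2)) ∪
      Set.range (fun z : E × Bool =>
        (.leg z.1 z.2 1 (Fin.last K), .star ⟨z.1, ((1 : G) : G ⧸ Sp.edgeSubgroup z.1)⟩))
    have hS₀ : S₀.Finite := (((Set.finite_iUnion fun a => (hS a).image _).union
      (Set.finite_range _)).union (Set.finite_range _)).union (Set.finite_range _)
    have key : ∀ y y', Sp.Link p Γ y y' → ∃ g : G, (g • y, g • y') ∈ S₀ := by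
      intro y y' h
      cases h with
      | inner a g v v' h =>
        obtain ⟨k, hk⟩ := hS' a v v' h
        refine ⟨Sp.incl a k * g⁻¹, Or.inl (Or.inl (Or.inl (Set.mem_iUnion.2 ⟨a, _, hk, ?_⟩)))⟩
        rw [smul_piece, smul_piece, smul_pieceMk, smul_pieceMk, inv_mul_cancel_right,
          ← one_mul (Sp.incl a k), pieceMk_mul, pieceMk_mul]
      | foot e σ g =>
        refine ⟨g⁻¹, Or.inl (Or.inl (Or.inr ⟨(e, σ), ?_⟩))⟩
        rw [smul_foot, smul_leg, inv_mul_cancel]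
      | step e σ g i j h =>
        refine ⟨g⁻¹, Or.inl (Or.inr ⟨(e, σ, i, j), ?_⟩)⟩
        rw [smul_leg, smul_leg, inv_mul_cancel]
      | top e σ g =>
        refine ⟨g⁻¹, Or.inr ⟨(e, σ), ?_⟩⟩
        rw [smul_leg, smul_star, inv_mul_cancel, MulAction.Quotient.smul_coe, smul_eq_mul,
          inv_mul_cancel]
    refine ⟨S₀ ∪ Prod.swap '' S₀, hS₀.union (hS₀.image _), fun y y' h => ?_⟩
    rcases h.2 with h | h
    · obtain ⟨g, hg⟩ := key _ _ h
      exact ⟨g, Or.inl hg⟩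
    · obtain ⟨g, hg⟩ := key _ _ h
      exact ⟨g, Or.inr ⟨_, hg, rfl⟩⟩

end Splitting

end GraphOfGroups

namespace GraphOfGroups

open SimpleGraph

variable {V : Type u} {E : Type v} {𝒢 : GraphOfGroups.{u, v, w, x} V E} {G : Type y} [Group G]

namespace Splitting

variable (Sp : 𝒢.Splitting G) {A : V → Type z} [∀ a, MulAction (𝒢.vertexGroup a) (A a)]
  {p : ∀ a, A a} {Γ : ∀ a, SimpleGraph (A a)} {K : ℕ}

/-! ### The decomposition of the tree of spaces -/

/-- The inclusion of a translate of the space attached to a vertex. -/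
def emb (i : V × G) (v : A i.1) : Sp.Vertex A K :=
  .piece i.1 (Sp.pieceMk i.1 i.2 v)

theorem emb_injective (i : V × G) : Function.Injective (Sp.emb i : A i.1 → Sp.Vertex A K) :=
  fun _ _ h => Sp.pieceMk_injective i.1 i.2 (eq_of_heq (Vertex.piece.inj h).2)

/-- The side of an edge of the tree on which a vertex lies. -/
noncomputable def vertexSide : Sp.Vertex A K → Sp.Star → ZMod 2
  | .piece a x => Quotient.lift (fun z : G × A a => Sp.side a z.1) (by
      rintro s t ⟨h, h1, -⟩
      exact (congrArg (Sp.side a) h1).trans (Sp.side_mul a _ h)) x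
  | .leg e σ g _ => Sp.side (vert 𝒢 e σ) (g * Sp.arm e σ)
  -- By convention a center lies on the source side of its own edge. With respect to all other edges
  -- the two ends of its edge agree.
  | .star s => Sp.side (𝒢.src s.1) (s.2.out * Sp.stable s.1)

theorem vertexSide_leg (e : E) (σ : Bool) (g : G) (j : Fin (K + 1)) :
    Sp.vertexSide (.leg e σ g j : Sp.Vertex A K) = Sp.side (vert 𝒢 e σ) (g * Sp.arm e σ) := rfl

theorem vertexSide_star (e : E) (g : G) :
    Sp.vertexSide (.star ⟨e, g⟩ : Sp.Vertex A K) = Sp.side (𝒢.src e) (g * Sp.stable e) :=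
  Sp.side_arm_eq (QuotientGroup.out_eq' _).symm false

/-- The side is constant on pieces and on legs with their feet. It can only change at the top of a
leg, and there only with respect to the star being reached. -/
theorem Link.eq_star {s : Sp.Star} {a b : Sp.Vertex A K} (h : Sp.Link p Γ a b)
    (hs : Sp.vertexSide a s ≠ Sp.vertexSide b s) : b = .star s := by
  cases h with
  | inner a g v v' h => exact absurd rfl hs
  | foot e σ g => exact absurd rfl hs
  | step e σ g i j h => exact absurd rfl hs
  | top e σ g =>
    by_contra hne
    refine hs ?_
    rw [vertexSide_leg, vertexSide_star]
    exact Sp.side_arm_of_ne (fun h => hne (congrArg _ h.symm)) σ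

variable (p K) in
/-- A leg is attached to a piece. -/
def Attached (i : V × G) (e : E) (σ : Bool) (k : G) : Prop :=
  (Sp.foot p e σ k : Sp.Vertex A K) ∈ Set.range (Sp.emb i)

theorem Attached.side_eq {i : V × G} {e : E} {σ : Bool} {k : G} (h : Sp.Attached p K i e σ k) :
    Sp.side (vert 𝒢 e σ) (k * Sp.arm e σ) = Sp.side i.1 i.2 := by
  obtain ⟨v, hv⟩ := h
  exact congrArg Sp.vertexSide hv.symm

/-- A piece lies on one side of each edge while the two ends of the edge lie on different sides. So
a piece meets a star through only one of its ends, even if the edge is a loop. -/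
theorem Attached.side_unique {i : V × G} {e : E} {σ σ' : Bool} {k k' : G}
    (h : Sp.Attached p K i e σ k) (h' : Sp.Attached p K i e σ' k')
    (hk : (k : G ⧸ Sp.edgeSubgroup e) = k') : σ = σ' := by
  by_contra hne
  refine Sp.side_arm_ne (e := e) (k := k) hne ?_
  rw [h.side_eq, ← Sp.side_arm_eq hk, h'.side_eq]

theorem mem_range_emb {i : V × G} {b : V} {g : G} {v : A b}
    (h : (.piece b (Sp.pieceMk b g v) : Sp.Vertex A K) ∈ Set.range (Sp.emb i)) (v' : A b) :
    (.piece b (Sp.pieceMk b g v') : Sp.Vertex A K) ∈ Set.range (Sp.emb i) := by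
  obtain ⟨a, k⟩ := i
  obtain ⟨u, hu⟩ := h
  obtain ⟨rfl, h1⟩ := Vertex.piece.inj hu
  obtain ⟨t, ht, -⟩ := Sp.pieceMk_eq.1 (eq_of_heq h1)
  refine ⟨t⁻¹ • v', ?_⟩
  dsimp only at ht
  simp only [ht, emb, pieceMk_mul, smul_inv_smul]

theorem exists_adj_of_inner {i : V × G} {b : V} {g : G} {v v' : A b}
    (hsmul : ∀ a (h : 𝒢.vertexGroup a) (v v' : A a), (Γ a).Adj v v' → (Γ a).Adj (h • v) (h • v'))
    (h : (Γ b).Adj v v') {u u' : A i.1}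
    (hu : (Sp.emb i u : Sp.Vertex A K) = .piece b (Sp.pieceMk b g v))
    (hu' : (Sp.emb i u' : Sp.Vertex A K) = .piece b (Sp.pieceMk b g v')) : (Γ i.1).Adj u u' := by
  obtain ⟨a, k⟩ := i
  obtain ⟨rfl, h1⟩ := Vertex.piece.inj hu
  obtain ⟨t, ht, h2⟩ := Sp.pieceMk_eq.1 (eq_of_heq h1)
  have h3 : Sp.pieceMk a k u' = Sp.pieceMk a g v' := eq_of_heq (Vertex.piece.inj hu').2
  dsimp only at ht
  rw [ht, pieceMk_mul] at h3
  have h4 := Sp.pieceMk_injective a g h3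
  rw [h2, ← h4] at h
  simpa using hsmul a t⁻¹ _ _ h

theorem dist_smul_le {a : V} (hΓ : (Γ a).Connected)
    (hsmul : ∀ a (h : 𝒢.vertexGroup a) (v v' : A a), (Γ a).Adj v v' → (Γ a).Adj (h • v) (h • v'))
    (h : 𝒢.vertexGroup a) (v v' : A a) : (Γ a).dist (h • v) (h • v') ≤ (Γ a).dist v v' :=
  dist_le_of_lazy_map hΓ hΓ _ (fun v v' hv => Or.inr (hsmul a h v v' hv)) v v'

/-- The feet of one coset at one end are translates of the base point by the edge group, hence lie
in the same piece within `K` of each other. -/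
theorem Attached.of_coset_eq {i : V × G} {e : E} {σ : Bool} {k k' : G}
    (h : Sp.Attached p K i e σ k) (hk : (k : G ⧸ Sp.edgeSubgroup e) = k')
    (hΓ : ∀ a, (Γ a).Connected)
    (hsmul : ∀ a (h : 𝒢.vertexGroup a) (v v' : A a), (Γ a).Adj v v' → (Γ a).Adj (h • v) (h • v'))
    (hK : ∀ e σ h, (Γ (vert 𝒢 e σ)).dist (p _) (endHom 𝒢 e σ h • p _) ≤ K) :
    ∃ u u', (Sp.emb i u : Sp.Vertex A K) = Sp.foot p e σ k ∧
      (Sp.emb i u' : Sp.Vertex A K) = Sp.foot p e σ k' ∧ (Γ i.1).dist u u' ≤ K := by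
  obtain ⟨a, g⟩ := i
  obtain ⟨u, hu⟩ := h
  obtain ⟨c, hc⟩ := Sp.exists_of_coset_eq hk σ
  obtain ⟨rfl, h1⟩ := Vertex.piece.inj hu
  obtain ⟨t, ht, h2⟩ := Sp.pieceMk_eq.1 (eq_of_heq h1)
  dsimp only at ht u
  refine ⟨u, t⁻¹ • endHom 𝒢 e σ c • p _, hu, ?_, ?_⟩
  · simp only [foot, emb, ht, hc, pieceMk_mul, smul_inv_smul]
  · have : u = t⁻¹ • p (vert 𝒢 e σ) := by rw [h2, inv_smul_smul]
    rw [this]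
    exact (dist_smul_le (hΓ _) hsmul _ _ _).trans (hK e σ c)

variable (p K) in
/-- The vertices hanging behind a star attached to a piece. -/
def branch (i : V × G) (s : Sp.Star) : Set (Sp.Vertex A K) :=
  {y | y ∉ Set.range (Sp.emb i) ∧ (∃ (e : E) (σ : Bool) (k : G), s = ⟨e, (k : G ⧸ Sp.edgeSubgroup e)⟩ ∧
      Sp.Attached p K i e σ k) ∧
    (y = .star s ∨ Sp.vertexSide y s ≠ Sp.side i.1 i.2 s ∨
      ∃ (e : E) (σ : Bool) (k : G) (j : Fin (K + 1)), y = .leg e σ k j ∧ s = ⟨e, (k : G ⧸ Sp.edgeSubgroup e)⟩ ∧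
        Sp.Attached p K i e σ k)}

theorem leg_notMem_range (i : V × G) (e : E) (σ : Bool) (k : G) (j : Fin (K + 1)) :
    (.leg e σ k j : Sp.Vertex A K) ∉ Set.range (Sp.emb i) := by
  rintro ⟨v, hv⟩
  cases hv

theorem star_notMem_range (i : V × G) (s : Sp.Star) :
    (.star s : Sp.Vertex A K) ∉ Set.range (Sp.emb i) := by
  rintro ⟨v, hv⟩
  cases hv

theorem Attached.leg_mem_branch {i : V × G} {e : E} {σ : Bool} {k : G}
    (h : Sp.Attached p K i e σ k) (j : Fin (K + 1)) :
    (.leg e σ k j : Sp.Vertex A K) ∈ Sp.branch p K i ⟨e, k⟩ :=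
  ⟨Sp.leg_notMem_range i e σ k j, ⟨e, σ, k, rfl, h⟩, Or.inr (Or.inr ⟨e, σ, k, j, rfl, rfl, h⟩)⟩

theorem Attached.star_mem_branch {i : V × G} {e : E} {σ : Bool} {k : G}
    (h : Sp.Attached p K i e σ k) :
    (.star ⟨e, k⟩ : Sp.Vertex A K) ∈ Sp.branch p K i ⟨e, k⟩ :=
  ⟨Sp.star_notMem_range i _, ⟨e, σ, k, rfl, h⟩, Or.inl rfl⟩

theorem Attached.eq_of_leg_mem_branch {i : V × G} {e : E} {σ : Bool} {k : G} {j : Fin (K + 1)}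
    {s : Sp.Star} (h : Sp.Attached p K i e σ k)
    (hs : (.leg e σ k j : Sp.Vertex A K) ∈ Sp.branch p K i s) : s = ⟨e, k⟩ := by
  rcases hs.2.2 with h1 | h1 | ⟨e', σ', k', j', h1, h2, -⟩
  · cases h1
  · exact absurd (by rw [vertexSide_leg, h.side_eq]) h1
  · obtain ⟨rfl, -, rfl, -⟩ := Vertex.leg.inj h1
    exact h2

theorem Link.mem_branch {i : V × G} {s : Sp.Star} {a b : Sp.Vertex A K} (h : Sp.Link p Γ a b)
    (ha : a ∈ Sp.branch p K i s) (hb : b ∉ Set.range (Sp.emb i)) : b ∈ Sp.branch p K i s := by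
  refine ⟨hb, ha.2.1, ?_⟩
  rcases ha.2.2 with rfl | h1 | ⟨e, σ, k, j, rfl, rfl, h2⟩
  · cases h
  · by_cases h2 : Sp.vertexSide b s = Sp.side i.1 i.2 s
    · rw [← h2] at h1
      exact Or.inl (h.eq_star Sp h1)
    · exact Or.inr (Or.inl h2)
  · cases h with
    | step _ _ _ _ j' _ => exact Or.inr (Or.inr ⟨e, σ, k, j', rfl, rfl, h2⟩)
    | top => exact Or.inl rfl

/-! ### Branches of the complement of a piece -/

section Branches

variable (hΓ : ∀ a, (Γ a).Connected)
  (hsmul : ∀ a (h : 𝒢.vertexGroup a) (v v' : A a), (Γ a).Adj v v' → (Γ a).Adj (h • v) (h • v'))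
  (hK : ∀ e σ h, (Γ (vert 𝒢 e σ)).dist (p _) (endHom 𝒢 e σ h • p _) ≤ K)

include hΓ hsmul hK

/-- At the end of the star that meets the piece, every leg of the coset is attached; the legs at the
other end are separated from the piece by the star. -/
theorem leg_mem_branch_of_star_mem {i : V × G} {e : E} {k : G}
    (h : (.star ⟨e, k⟩ : Sp.Vertex A K) ∈ Sp.branch p K i ⟨e, k⟩) (σ : Bool) (j : Fin (K + 1)) :
    (.leg e σ k j : Sp.Vertex A K) ∈ Sp.branch p K i ⟨e, k⟩ := by
  obtain ⟨e₀, σ₀, k₀, hs, hk₀⟩ := h.2.1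
  obtain ⟨rfl, hk⟩ := Sigma.mk.inj hs
  have hk := eq_of_heq hk
  have hatt : Sp.Attached p K i e σ₀ k := by
    obtain ⟨-, u', -, hu', -⟩ := hk₀.of_coset_eq Sp hk.symm hΓ hsmul hK
    exact ⟨u', hu'⟩
  by_cases hσ : σ = σ₀
  · subst hσ
    exact hatt.leg_mem_branch Sp j
  · refine ⟨Sp.leg_notMem_range i e σ k j, ⟨e, σ₀, k, rfl, hatt⟩, Or.inr (Or.inl ?_)⟩
    rw [vertexSide_leg, ← hatt.side_eq]
    exact Sp.side_arm_ne hσ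

theorem Link.mem_branch' {i : V × G} {s : Sp.Star} {a b : Sp.Vertex A K} (h : Sp.Link p Γ a b)
    (hb : b ∈ Sp.branch p K i s) (ha : a ∉ Set.range (Sp.emb i)) : a ∈ Sp.branch p K i s := by
  have key : b = .star s → a ∈ Sp.branch p K i s := by
    rintro rfl
    cases h with
    | top e σ k => exact Sp.leg_mem_branch_of_star_mem hΓ hsmul hK hb σ _
  rcases hb.2.2 with h1 | h1 | ⟨e, σ, k, j, rfl, rfl, h2⟩
  · exact key h1
  · by_cases h2 : Sp.vertexSide a s = Sp.side i.1 i.2 s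
    · rw [← h2] at h1
      exact key (h.eq_star Sp h1.symm)
    · exact ⟨ha, hb.2.1, Or.inr (Or.inl h2)⟩
  · cases h with
    | foot => exact absurd h2 ha
    | step _ _ _ j' _ _ => exact ⟨ha, hb.2.1, Or.inr (Or.inr ⟨e, σ, k, j', rfl, rfl, h2⟩)⟩

theorem mem_branch_of_adj {i : V × G} {s : Sp.Star} {a b : Sp.Vertex A K}
    (ha : a ∈ Sp.branch p K i s) (h : (Sp.treeOfSpaces K p Γ).Adj a b)
    (hb : b ∉ Set.range (Sp.emb i)) : b ∈ Sp.branch p K i s := by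
  rcases h.2 with h | h
  · exact h.mem_branch Sp ha hb
  · exact h.mem_branch' Sp hΓ hsmul hK ha hb

omit hΓ hsmul hK in
theorem exists_leg_of_adj_emb {i : V × G} {v : A i.1} {b : Sp.Vertex A K}
    (h : (Sp.treeOfSpaces K p Γ).Adj (Sp.emb i v) b) (hb : b ∉ Set.range (Sp.emb i)) :
    ∃ e σ k, b = .leg e σ k 0 ∧ (Sp.foot p e σ k : Sp.Vertex A K) = Sp.emb i v := by
  rcases h.2 with h | h
  · generalize hy : (Sp.emb i v : Sp.Vertex A K) = y at h
    cases h with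
    | inner a g u u' h => exact absurd (Sp.mem_range_emb ⟨v, hy⟩ u') hb
    | foot e σ k => exact ⟨e, σ, k, rfl, rfl⟩
    | step => cases hy
    | top => cases hy
  · generalize hy : (Sp.emb i v : Sp.Vertex A K) = y at h
    cases h with
    | inner a g u u' h => exact absurd (Sp.mem_range_emb ⟨v, hy⟩ u) hb
    | foot => cases hy
    | step => cases hy
    | top => cases hy

/-- Follow a walk to the piece. Membership in a branch is invariant along edges outside the piece,
and the last vertex before entering is the bottom of an attached leg, which determines its star. -/
theorem existsUnique_branch [Nonempty V] (i : V × G) (y : Sp.Vertex A K)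
    (hy : y ∉ Set.range (Sp.emb i)) : ∃! s, y ∈ Sp.branch p K i s := by
  obtain ⟨q⟩ := (Sp.connected_treeOfSpaces (p := p) (K := K) hΓ).preconnected y (Sp.emb i (p i.1))
  generalize hz : (Sp.emb i (p i.1) : Sp.Vertex A K) = z at q
  induction q with
  | nil => exact absurd ⟨_, hz⟩ hy
  | @cons y y₁ z h q ih =>
    by_cases hy₁ : y₁ ∈ Set.range (Sp.emb i)
    · obtain ⟨v, rfl⟩ := hy₁
      obtain ⟨e, σ, k, rfl, hk⟩ := Sp.exists_leg_of_adj_emb h.symm hy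
      have hatt : Sp.Attached p K i e σ k := ⟨v, hk.symm⟩
      exact ⟨_, hatt.leg_mem_branch Sp 0, fun s hs => hatt.eq_of_leg_mem_branch Sp hs⟩
    · obtain ⟨s, hs, huniq⟩ := ih hy₁ hz
      exact ⟨s, Sp.mem_branch_of_adj hΓ hsmul hK hs h.symm hy, fun s' hs' =>
        huniq s' (Sp.mem_branch_of_adj hΓ hsmul hK hs' h hy₁)⟩

end Branches

/-! ### Retraction onto a piece -/

open Classical in
variable (p) in
/-- The coordinate in a piece of a vertex of this piece. -/
noncomputable def coord (i : V × G) (y : Sp.Vertex A K) : A i.1 :=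
  if h : ∃ v, Sp.emb i v = y then h.choose else p i.1

theorem coord_emb (i : V × G) (v : A i.1) : Sp.coord p i (Sp.emb i v : Sp.Vertex A K) = v := by
  have h : ∃ v', (Sp.emb i v' : Sp.Vertex A K) = Sp.emb i v := ⟨v, rfl⟩
  rw [coord, dif_pos h]
  exact Sp.emb_injective i h.choose_spec

theorem emb_coord {i : V × G} {y : Sp.Vertex A K} (h : y ∈ Set.range (Sp.emb i)) :
    Sp.emb i (Sp.coord p i y) = y := by
  obtain ⟨v, rfl⟩ := h
  rw [coord_emb]

open Classical in
variable (p K) in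
/-- The point of a piece to which the branch behind a star retracts. -/
noncomputable def center (i : V × G) (s : Sp.Star) : A i.1 :=
  if h : ∃ t : Bool × G, Sp.Attached p K i s.1 t.1 t.2 ∧ (t.2 : G ⧸ Sp.edgeSubgroup s.1) = s.2 then
    Sp.coord p i (Sp.foot p s.1 h.choose.1 h.choose.2 : Sp.Vertex A K) else p i.1

/-- The foot selected for `s` may come from another representative `k'`, but it is at the same end
`σ` because a piece meets only one end of a star. -/
theorem exists_emb_center {i : V × G} {s : Sp.Star} {e : E} {σ : Bool} {k : G}
    (hs : s = ⟨e, (k : G ⧸ Sp.edgeSubgroup e)⟩) (h : Sp.Attached p K i e σ k) :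
    ∃ k' : G, (k : G ⧸ Sp.edgeSubgroup e) = k' ∧
      (Sp.emb i (Sp.center p K i s) : Sp.Vertex A K) = Sp.foot p e σ k' := by
  subst hs
  have hc : ∃ t : Bool × G, Sp.Attached p K i e t.1 t.2 ∧
      (t.2 : G ⧸ Sp.edgeSubgroup e) = k := ⟨(σ, k), h, rfl⟩
  have hspec := hc.choose_spec
  refine ⟨hc.choose.2, hspec.2.symm, ?_⟩
  rw [center, dif_pos hc, Sp.emb_coord hspec.1, h.side_unique Sp hspec.1 hspec.2.symm]

section Retraction

variable (hΓ : ∀ a, (Γ a).Connected)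

open Classical in
variable (p K) in
/-- The retraction of the complement of a piece that sends a whole branch to one point. -/
noncomputable def outer (i : V × G) (y : Sp.Vertex A K) : A i.1 :=
  if h : ∃ s, y ∈ Sp.branch p K i s then Sp.center p K i h.choose else p i.1

open Classical in
variable (p K) in
/-- The retraction of the tree of spaces onto a piece. -/
noncomputable def retr (i : V × G) : Sp.Vertex A K → A i.1
  | .piece b x => if (.piece b x : Sp.Vertex A K) ∈ Set.range (Sp.emb i) then
      Sp.coord p i (.piece b x : Sp.Vertex A K) else Sp.outer p K i (.piece b x)
  | .leg e σ k j => if Sp.Attached p K i e σ k then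
      ((hΓ i.1).exists_walk_length_eq_dist (Sp.coord p i (Sp.foot p e σ k : Sp.Vertex A K))
        (Sp.center p K i ⟨e, k⟩)).choose.getVert j else Sp.outer p K i (.leg e σ k j)
  | .star s => Sp.outer p K i (.star s)

theorem retr_emb (i : V × G) (v : A i.1) :
    Sp.retr p K hΓ i (Sp.emb i v) = v := by
  refine (if_pos ?_).trans (Sp.coord_emb i v)
  exact ⟨v, rfl⟩

theorem retr_leg_zero {i : V × G} {v : A i.1} {e : E} {σ : Bool} {k : G}
    (h : (Sp.foot p e σ k : Sp.Vertex A K) = Sp.emb i v) :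
    Sp.retr p K hΓ i (.leg e σ k 0) = v := by
  have hatt : Sp.Attached p K i e σ k := ⟨v, h.symm⟩
  refine (if_pos hatt).trans ?_
  rw [Fin.val_zero, Walk.getVert_zero, h, coord_emb]

theorem retr_eq_outer {i : V × G} {y : Sp.Vertex A K} (hy : y ∉ Set.range (Sp.emb i))
    (hleg : ∀ e σ k j, y = .leg e σ k j → ¬ Sp.Attached p K i e σ k) :
    Sp.retr p K hΓ i y = Sp.outer p K i y := by
  cases y with
  | piece b x => exact if_neg hy
  | leg e σ k j => exact if_neg (hleg e σ k j rfl)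
  | star s => rfl

/-- A leg is laid along a geodesic from its own foot to the selected foot of the star. This has
length at most `K`, so it is completed within the `K + 1` vertices of the leg. -/
theorem exists_walk_retr (i : V × G) {e : E} {σ : Bool} {k : G} (h : Sp.Attached p K i e σ k)
    (hsmul : ∀ a (h : 𝒢.vertexGroup a) (v v' : A a), (Γ a).Adj v v' → (Γ a).Adj (h • v) (h • v'))
    (hK : ∀ e σ h, (Γ (vert 𝒢 e σ)).dist (p _) (endHom 𝒢 e σ h • p _) ≤ K) :
    ∃ q : (Γ i.1).Walk (Sp.coord p i (Sp.foot p e σ k : Sp.Vertex A K))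
      (Sp.center p K i ⟨e, k⟩), q.length ≤ K ∧
        ∀ j : Fin (K + 1), Sp.retr p K hΓ i (.leg e σ k j) = q.getVert j := by
  have hq := (hΓ i.1).exists_walk_length_eq_dist
    (Sp.coord p i (Sp.foot p e σ k : Sp.Vertex A K)) (Sp.center p K i ⟨e, k⟩)
  refine ⟨hq.choose, ?_, fun j => if_pos h⟩
  rw [hq.choose_spec]
  obtain ⟨k', hk, hc⟩ := Sp.exists_emb_center rfl h
  obtain ⟨u, u', hu, hu', hd⟩ := h.of_coset_eq Sp hk hΓ hsmul hK
  rw [← hu, coord_emb]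
  rw [← hu'] at hc
  rwa [Sp.emb_injective i hc]

variable (hsmul : ∀ a (h : 𝒢.vertexGroup a) (v v' : A a),
    (Γ a).Adj v v' → (Γ a).Adj (h • v) (h • v'))
  (hK : ∀ e σ h, (Γ (vert 𝒢 e σ)).dist (p _) (endHom 𝒢 e σ h • p _) ≤ K)

include hΓ hsmul hK

theorem outer_eq [Nonempty V] {i : V × G} {s : Sp.Star} {y : Sp.Vertex A K}
    (hy : y ∈ Sp.branch p K i s) : Sp.outer p K i y = Sp.center p K i s := by
  have h : ∃ s, y ∈ Sp.branch p K i s := ⟨s, hy⟩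
  rw [outer, dif_pos h]
  congr 1
  exact (Sp.existsUnique_branch hΓ hsmul hK i y hy.1).unique h.choose_spec hy

theorem outer_eq_of_adj [Nonempty V] {i : V × G} {a b : Sp.Vertex A K}
    (ha : a ∉ Set.range (Sp.emb i)) (hb : b ∉ Set.range (Sp.emb i))
    (h : (Sp.treeOfSpaces K p Γ).Adj a b) : Sp.outer p K i a = Sp.outer p K i b := by
  obtain ⟨s, hs, -⟩ := Sp.existsUnique_branch hΓ hsmul hK i a ha
  rw [Sp.outer_eq hΓ hsmul hK hs,
    Sp.outer_eq hΓ hsmul hK (Sp.mem_branch_of_adj hΓ hsmul hK hs h hb)]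

/-- Off the piece and its attached legs the map is constant on branches. An attached leg follows its
geodesic, starting at the image of its foot and arriving at the common value `center` before the
star is reached. -/
theorem Link.retr [Nonempty V] {i : V × G} {a b : Sp.Vertex A K} (h : Sp.Link p Γ a b) :
    Sp.retr p K hΓ i a = Sp.retr p K hΓ i b ∨
      (Γ i.1).Adj (Sp.retr p K hΓ i a) (Sp.retr p K hΓ i b) := by
  have hadj := h.adj
  cases h with
  | inner b g v v' h =>
    by_cases hr : (.piece b (Sp.pieceMk b g v) : Sp.Vertex A K) ∈ Set.range (Sp.emb i)
    · obtain ⟨u', hu'⟩ := Sp.mem_range_emb hr v'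
      obtain ⟨u, hu⟩ := hr
      right
      rw [← hu, ← hu', retr_emb, retr_emb]
      exact Sp.exists_adj_of_inner hsmul h hu hu'
    · have hr' : (.piece b (Sp.pieceMk b g v') : Sp.Vertex A K) ∉ Set.range (Sp.emb i) :=
        fun h => hr (Sp.mem_range_emb h v)
      left
      rw [Sp.retr_eq_outer hΓ hr (by rintro _ _ _ _ ⟨⟩),
        Sp.retr_eq_outer hΓ hr' (by rintro _ _ _ _ ⟨⟩)]
      exact Sp.outer_eq_of_adj hΓ hsmul hK hr hr' hadj
  | foot e σ g =>
    left
    by_cases hr : Sp.Attached p K i e σ g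
    · obtain ⟨v, hv⟩ := hr
      rw [Sp.retr_leg_zero hΓ hv.symm, ← hv, retr_emb]
    · rw [Sp.retr_eq_outer hΓ hr (by rintro _ _ _ _ ⟨⟩),
        Sp.retr_eq_outer hΓ (Sp.leg_notMem_range i e σ g 0) (by rintro _ _ _ _ ⟨⟩; exact hr)]
      exact Sp.outer_eq_of_adj hΓ hsmul hK hr (Sp.leg_notMem_range i e σ g 0) hadj
  | step e σ g j j' h =>
    by_cases hr : Sp.Attached p K i e σ g
    · obtain ⟨q, hq, hqv⟩ := Sp.exists_walk_retr hΓ i hr hsmul hK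
      rw [hqv, hqv, ← h]
      rcases lt_or_ge (j : ℕ) q.length with hj | hj
      · exact Or.inr (q.adj_getVert_succ hj)
      · left
        rw [q.getVert_of_length_le hj, q.getVert_of_length_le (hj.trans (Nat.le_succ _))]
    · left
      rw [Sp.retr_eq_outer hΓ (Sp.leg_notMem_range i e σ g j) (by rintro _ _ _ _ ⟨⟩; exact hr),
        Sp.retr_eq_outer hΓ (Sp.leg_notMem_range i e σ g j') (by rintro _ _ _ _ ⟨⟩; exact hr)]
      exact Sp.outer_eq_of_adj hΓ hsmul hK (Sp.leg_notMem_range i e σ g j)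
        (Sp.leg_notMem_range i e σ g j') hadj
  | top e σ g =>
    left
    by_cases hr : Sp.Attached p K i e σ g
    · obtain ⟨q, hq, hqv⟩ := Sp.exists_walk_retr hΓ i hr hsmul hK
      rw [hqv, Fin.val_last, q.getVert_of_length_le hq]
      exact (Sp.outer_eq hΓ hsmul hK (hr.star_mem_branch Sp)).symm
    · rw [Sp.retr_eq_outer hΓ (Sp.leg_notMem_range i e σ g _) (by rintro _ _ _ _ ⟨⟩; exact hr)]
      exact Sp.outer_eq_of_adj hΓ hsmul hK (Sp.leg_notMem_range i e σ g _)
        (Sp.star_notMem_range i _) hadj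

/-- The selected foot is within `K + 2` of the star, and an attached leg retracts within `K` of this
foot. -/
theorem dist_emb_retr_le [Nonempty V] {i : V × G} {s : Sp.Star} {y : Sp.Vertex A K}
    (hy : y ∈ Sp.branch p K i s) :
    (Sp.treeOfSpaces K p Γ).dist (Sp.emb i (Sp.retr p K hΓ i y)) (.star s) ≤ 2 * K + 2 := by
  have hX := Sp.connected_treeOfSpaces (p := p) (K := K) hΓ
  have hcenter : (Sp.treeOfSpaces K p Γ).dist (Sp.emb i (Sp.center p K i s)) (.star s) ≤ K + 2 := by
    obtain ⟨e, σ, k, rfl, hk⟩ := hy.2.1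
    obtain ⟨k', hk', hc⟩ := Sp.exists_emb_center rfl hk
    rw [hc, hk']
    exact Sp.dist_foot_star_le e σ k'
  by_cases hleg : ∃ e σ k j, y = .leg e σ k j ∧ Sp.Attached p K i e σ k
  · obtain ⟨e, σ, k, j, rfl, hk⟩ := hleg
    obtain rfl := hk.eq_of_leg_mem_branch Sp hy
    obtain ⟨q, hq, hqv⟩ := Sp.exists_walk_retr hΓ i hk hsmul hK
    have h1 := dist_le (q.drop j)
    have h2 : (Sp.treeOfSpaces K p Γ).dist (Sp.emb i (q.getVert j))
        (Sp.emb i (Sp.center p K i ⟨e, k⟩)) ≤ _ :=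
      dist_le_of_lazy_map (hΓ i.1) hX (Sp.emb i)
        (fun v v' h => Or.inr (Link.inner i.1 i.2 v v' h).adj) _ _
    have h3 := hX.dist_triangle (u := Sp.emb i (q.getVert j))
      (v := Sp.emb i (Sp.center p K i ⟨e, k⟩)) (w := .star ⟨e, k⟩)
    rw [Walk.drop_length] at h1
    rw [hqv]
    omega
  · rw [Sp.retr_eq_outer hΓ hy.1 (fun e σ k j h hk => hleg ⟨e, σ, k, j, h, hk⟩),
      Sp.outer_eq hΓ hsmul hK hy]
    omega

omit hΓ hsmul hK in
theorem location (y : Sp.Vertex A K) :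
    (∃ i : V × G, ∀ s, y ≠ .star s ∧ Sp.vertexSide y s = Sp.side i.1 i.2 s) ∨
      ∃ (s₀ : Sp.Star) (i j : V × G), y = .star s₀ ∧ Sp.side i.1 i.2 s₀ ≠ Sp.side j.1 j.2 s₀ ∧
        ∀ s, s ≠ s₀ → y ≠ .star s ∧ Sp.vertexSide y s = Sp.side i.1 i.2 s ∧
          Sp.vertexSide y s = Sp.side j.1 j.2 s := by
  cases y with
  | piece a x =>
    induction x using PieceVertex.ind with
    | h g v => exact Or.inl ⟨(a, g), fun s => ⟨(by rintro ⟨⟩), rfl⟩⟩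
  | leg e σ g j =>
    exact Or.inl ⟨(vert 𝒢 e σ, g * Sp.arm e σ), fun s => ⟨(by rintro ⟨⟩), rfl⟩⟩
  | star s =>
    obtain ⟨e, q⟩ := s
    obtain ⟨g, rfl⟩ := QuotientGroup.mk_surjective q
    refine Or.inr ⟨_, (𝒢.tgt e, g), (𝒢.src e, g * Sp.stable e), rfl, Sp.side_stable_ne e g,
      fun s hs => ⟨fun h => hs (Vertex.star.inj h).symm, ?_, ?_⟩⟩
    · rw [vertexSide_star]
      exact (Sp.side_stable_of_ne e g s hs).symm
    · rw [vertexSide_star]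

/-- The tree of spaces is decomposed along the centers of the stars. -/
noncomputable def starDecomposition [Nonempty V] :
    StarDecomposition (Sp.treeOfSpaces K p Γ) (fun i : V × G => Γ i.1) Sp.Star (2 * K + 2) where
  pt := .star
  side s y := Sp.vertexSide y s
  side_eq_or s a b h hs := by
    rcases h.2 with h | h
    · exact Or.inr (h.eq_star Sp hs)
    · exact Or.inl (h.eq_star Sp hs.symm)
  emb := Sp.emb
  emb_adj i a b h := (Link.inner i.1 i.2 a b h).adj
  pieceSide i := Sp.side i.1 i.2
  retr := Sp.retr p K hΓ
  retr_emb := Sp.retr_emb hΓ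
  retr_adj i a b h := by
    rcases h.2 with h | h
    · exact h.retr Sp hΓ hsmul hK
    · exact (h.retr Sp hΓ hsmul hK).imp Eq.symm Adj.symm
  retr_eq_of_adj i a b h hb := by
    obtain ⟨e, σ, k, rfl, hk⟩ := Sp.exists_leg_of_adj_emb h hb
    exact Sp.retr_leg_zero hΓ hk
  branch := Sp.branch p K
  exists_mem_branch i a ha := (Sp.existsUnique_branch hΓ hsmul hK i a ha).exists
  mem_branch_of_adj i s a b ha h hb := Sp.mem_branch_of_adj hΓ hsmul hK ha h hb
  dist_pt_le i s a ha h := by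
    rcases ha.2.2 with rfl | h1 | ⟨e, σ, k, j, rfl, rfl, h2⟩
    · simp
    · rcases h with rfl | h
      · simp
      · exact absurd h h1
    · exact (Sp.dist_leg_star_le e σ k j).trans (by omega)
  dist_retr_le i s a ha := Sp.dist_emb_retr_le hΓ hsmul hK ha
  location := Sp.location

end Retraction

end Splitting

end GraphOfGroups

namespace ShortcutGraph

variable {V : Type u} {E : Type v} {𝒢 : GraphOfGroups.{u, v, w, x} V E}

/-! ### Fundamental groups of graphs of groups -/

/-- The source of the leg length `K`: there are finitely many edges, and every edge group is finite,
so base points are moved by a bounded amount. -/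
theorem exists_dist_endHom_le [Finite E] (hfin : ∀ e, Finite (𝒢.edgeGroup e)) {A : V → Type*}
    [∀ a, MulAction (𝒢.vertexGroup a) (A a)] (p : ∀ a, A a) (Γ : ∀ a, SimpleGraph (A a)) :
    ∃ K, ∀ e σ h, (Γ (GraphOfGroups.Splitting.vert 𝒢 e σ)).dist (p _)
      (GraphOfGroups.Splitting.endHom 𝒢 e σ h • p _) ≤ K := by
  obtain ⟨K, hK⟩ := Finite.exists_le fun t : (Σ e, Bool × 𝒢.edgeGroup e) =>
    (Γ (GraphOfGroups.Splitting.vert 𝒢 t.1 t.2.1)).dist (p _)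
      (GraphOfGroups.Splitting.endHom 𝒢 t.1 t.2.1 t.2.2 • p _)
  exact ⟨K, fun e σ h => hK ⟨e, σ, h⟩⟩

variable [Finite V] [Finite E] [Nonempty V] {G : Type (max u v w)} [Group G]

theorem isShortcutGroup_of_splitting (Sp : 𝒢.Splitting G) (hfin : ∀ e, Finite (𝒢.edgeGroup e))
    (h : ∀ a, IsShortcutGroup (𝒢.vertexGroup a)) : IsShortcutGroup G := by
  choose A Γ inst hΓ hact using h
  choose hconn θ hθ using hΓ
  have p : ∀ a, A a := fun a => (hconn a).nonempty.some
  obtain ⟨K, hK⟩ := exists_dist_endHom_le hfin p Γ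
  obtain ⟨M, hM⟩ := Finite.exists_le θ
  have hX := Sp.connected_treeOfSpaces (p := p) (K := K) hconn
  exact ⟨_, Sp.treeOfSpaces K p Γ, inferInstance,
    isShortcutGraph_of_starDecomposition hX
      (Sp.starDecomposition hconn (fun a => (hact a).adj_smul) hK) (fun i => hconn i.1) M
      (fun i n hn f hf => (hθ i.1 n hn f hf).trans (hM i.1)),
    Sp.isProperCocompactAction_treeOfSpaces hfin hact⟩

theorem isStronglyShortcutGroup_of_splitting (Sp : 𝒢.Splitting G)
    (hfin : ∀ e, Finite (𝒢.edgeGroup e)) (h : ∀ a, IsStronglyShortcutGroup (𝒢.vertexGroup a)) :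
    IsStronglyShortcutGroup G := by
  choose A Γ inst hΓ hact using h
  have hconn := fun a => (hΓ a).1
  choose c hc using fun a => (hΓ a).exists_noQuasiIsometricCycles
  have p : ∀ a, A a := fun a => (hconn a).nonempty.some
  obtain ⟨K, hK⟩ := exists_dist_endHom_le hfin p Γ
  obtain ⟨M, hM⟩ := Finite.exists_le c
  have hX := Sp.connected_treeOfSpaces (p := p) (K := K) hconn
  exact ⟨_, Sp.treeOfSpaces K p Γ, inferInstance,
    isStronglyShortcutGraph_of_noQuasiIsometricCycles hX
      ((Sp.starDecomposition hconn (fun a => (hact a).adj_smul) hK).noQuasiIsometricCycles hX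
        (fun i => hconn i.1) (fun i => (hc i.1).mono (hM i.1))),
    Sp.isProperCocompactAction_treeOfSpaces hfin hact⟩

end ShortcutGraph

namespace ShortcutGraph

theorem isShortcutGroup_fundamentalGroup {V : Type u} {E : Type v} [Finite V] [Finite E]
    (𝒢 : GraphOfGroups.{u, v, w, x} V E) (hfin : ∀ e, Finite (𝒢.edgeGroup e)) {T : Set E}
    (hT : 𝒢.IsSpanningTree T) (h : ∀ a, IsShortcutGroup (𝒢.vertexGroup a)) :
    IsShortcutGroup (𝒢.FundamentalGroup T) := by
  obtain ⟨Sp⟩ := GraphOfGroups.FundamentalGroup.nonempty_splitting 𝒢 hT hfin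
  have := hT.2.2.connected.nonempty
  exact isShortcutGroup_of_splitting Sp hfin h

theorem isStronglyShortcutGroup_fundamentalGroup {V : Type u} {E : Type v} [Finite V] [Finite E]
    (𝒢 : GraphOfGroups.{u, v, w, x} V E) (hfin : ∀ e, Finite (𝒢.edgeGroup e)) {T : Set E}
    (hT : 𝒢.IsSpanningTree T) (h : ∀ a, IsStronglyShortcutGroup (𝒢.vertexGroup a)) :
    IsStronglyShortcutGroup (𝒢.FundamentalGroup T) := by
  obtain ⟨Sp⟩ := GraphOfGroups.FundamentalGroup.nonempty_splitting 𝒢 hT hfin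
  have := hT.2.2.connected.nonempty
  exact isStronglyShortcutGroup_of_splitting Sp hfin h

/-! ### Transport along isomorphisms -/

theorem IsProperCocompactAction.compHom {G H : Type u} [Group G] [Group H] (f : H ≃* G)
    {V : Type v} {Γ : SimpleGraph V} [inst : MulAction G V] (h : IsProperCocompactAction G Γ) :
    @IsProperCocompactAction H _ V (MulAction.compHom V f.toMonoidHom) Γ := by
  let _ : MulAction H V := MulAction.compHom V f.toMonoidHom
  have hsmul : ∀ (k : H) (a : V), k • a = f k • a := fun _ _ => rfl
  refine ⟨fun k a b hab => h.adj_smul (f k) a b hab, fun a => ?_, ?_, ?_⟩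
  · have := h.finite_stabilizer a
    refine Finite.of_injective (β := MulAction.stabilizer G a)
      (fun k => ⟨f k.1, (hsmul k.1 a).symm.trans k.2⟩) fun k l hkl => ?_
    exact Subtype.ext (f.injective (congrArg Subtype.val hkl))
  · have := h.finite_vertex_orbits
    refine Finite.of_surjective (α := MulAction.orbitRel.Quotient G V)
      (Quotient.map' id ?_) ?_
    · rintro a b ⟨g, hg⟩
      refine ⟨f.symm g, ?_⟩
      change f (f.symm g) • b = a
      rw [f.apply_symm_apply]
      exact hg
    · intro q
      induction q using Quotient.inductionOn' with
      | h a => exact ⟨Quotient.mk'' a, rfl⟩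
  · obtain ⟨S, hS, hS'⟩ := h.finite_edge_orbits
    refine ⟨S, hS, fun a b hab => ?_⟩
    obtain ⟨g, hg⟩ := hS' a b hab
    refine ⟨f.symm g, ?_⟩
    rw [hsmul, hsmul, f.apply_symm_apply]
    exact hg

theorem IsShortcutGroup.of_mulEquiv {G H : Type u} [Group G] [Group H] (f : H ≃* G)
    (h : IsShortcutGroup G) : IsShortcutGroup H := by
  obtain ⟨V, Γ, inst, h1, h2⟩ := h
  exact ⟨V, Γ, MulAction.compHom V f.toMonoidHom, h1, h2.compHom f⟩

theorem IsStronglyShortcutGroup.of_mulEquiv {G H : Type u} [Group G] [Group H] (f : H ≃* G)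
    (h : IsStronglyShortcutGroup G) : IsStronglyShortcutGroup H := by
  obtain ⟨V, Γ, inst, h1, h2⟩ := h
  exact ⟨V, Γ, MulAction.compHom V f.toMonoidHom, h1, h2.compHom f⟩

end ShortcutGraph

/-! ### Amalgamated products and HNN extensions -/

namespace GraphOfGroups

section Amalgam

variable {G : Fin 2 → Type u} [∀ i, Group (G i)] {C : Type v} [Group C] (φ : ∀ i, C →* G i)
  (hφ : ∀ i, Function.Injective (φ i))

/-- The graph of groups of an amalgamated product: an edge with two vertices. -/
def amalgam : GraphOfGroups.{0, v, u, v} (Fin 2) PUnit.{v + 1} where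
  src _ := 0
  tgt _ := 1
  vertexGroup := G
  edgeGroup _ := C
  srcHom _ := φ 0
  tgtHom _ := φ 1
  srcHom_injective _ := hφ 0
  tgtHom_injective _ := hφ 1

theorem isSpanningTree_amalgam : (amalgam φ hφ).IsSpanningTree Set.univ := by
  refine ⟨fun e _ => show (0 : Fin 2) ≠ 1 by decide, fun _ _ _ _ _ => rfl, ⟨?_, ?_⟩⟩
  · have h01 : (SimpleGraph.fromRel fun a b : Fin 2 => ∃ e ∈ (Set.univ : Set PUnit.{v + 1}),
        (amalgam φ hφ).src e = a ∧ (amalgam φ hφ).tgt e = b).Adj 0 1 :=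
      ⟨by decide, Or.inl ⟨PUnit.unit, trivial, rfl, rfl⟩⟩
    have h0 : ∀ a : Fin 2, (SimpleGraph.fromRel fun a b : Fin 2 =>
        ∃ e ∈ (Set.univ : Set PUnit.{v + 1}),
        (amalgam φ hφ).src e = a ∧ (amalgam φ hφ).tgt e = b).Reachable 0 a := by
      intro a
      fin_cases a
      · exact SimpleGraph.Reachable.refl _
      · exact h01.reachable
    exact ⟨fun a b => (h0 a).symm.trans (h0 b)⟩
  · exact SimpleGraph.IsAcyclic.of_card_le_two (by simp)

/-- The fundamental group of the graph of groups of an amalgamated product. -/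
def amalgamEquiv :
    Monoid.PushoutI φ ≃* (amalgam φ hφ).FundamentalGroup Set.univ := by
  -- The only edge is in the tree, so its letter is trivial and the edge relation becomes the
  -- amalgamation relation.
  have hone : FundamentalGroup.stable (amalgam φ hφ) Set.univ PUnit.unit = 1 :=
    FundamentalGroup.stable_eq_one _ _ (Set.mem_univ _)
  have h01 : ∀ c, FundamentalGroup.incl (amalgam φ hφ) Set.univ 0 (φ 0 c) =
      FundamentalGroup.incl (amalgam φ hφ) Set.univ 1 (φ 1 c) := fun c => by
    have := FundamentalGroup.stable_mul (amalgam φ hφ) Set.univ PUnit.unit c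
    rw [hone, one_mul, mul_one] at this
    exact this
  let F : Monoid.PushoutI φ →* (amalgam φ hφ).FundamentalGroup Set.univ :=
    Monoid.PushoutI.lift (fun i => FundamentalGroup.incl (amalgam φ hφ) Set.univ i)
      ((FundamentalGroup.incl (amalgam φ hφ) Set.univ 0).comp (φ 0)) (by
        intro i
        fin_cases i
        · rfl
        · exact MonoidHom.ext fun c => (h01 c).symm)
  have hF : ∀ i (g : G i), F (Monoid.PushoutI.of i g) =
      FundamentalGroup.incl (amalgam φ hφ) Set.univ i g :=
    fun i g => Monoid.PushoutI.lift_of _ _ _ g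
  let F' : (amalgam φ hφ).FundamentalGroup Set.univ →* Monoid.PushoutI φ :=
    FundamentalGroup.lift (amalgam φ hφ) (fun i => Monoid.PushoutI.of i) (fun _ => 1) (by
        intro e c
        rw [one_mul, mul_one]
        exact (Monoid.PushoutI.of_apply_eq_base φ 0 c).trans
          (Monoid.PushoutI.of_apply_eq_base φ 1 c).symm)
      (fun _ _ => rfl)
  have hF' : ∀ i (g : G i), F' (FundamentalGroup.incl (amalgam φ hφ) Set.univ i g) =
      Monoid.PushoutI.of i g :=
    fun i g => FundamentalGroup.lift_incl (amalgam φ hφ) _ _ _ _ i g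
  refine MonoidHom.toMulEquiv F F' ?_ ?_
  · exact Monoid.PushoutI.hom_ext_nonempty fun i => MonoidHom.ext fun g =>
      (congrArg F' (hF i g)).trans (hF' i g)
  · refine FundamentalGroup.hom_ext _ (fun i g => (congrArg F (hF' i g)).trans (hF i g))
      fun e => ?_
    have ht : F' (FundamentalGroup.stable (amalgam φ hφ) Set.univ e) = 1 :=
      FundamentalGroup.lift_stable (amalgam φ hφ) _ _ _ _ e
    exact (congrArg F ht).trans ((map_one F).trans hone.symm)

end Amalgam

section HNN

variable {G : Type u} [Group G] {A B : Subgroup G} (φ : A ≃* B)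

/-- The graph of groups of an HNN extension: a loop. -/
def hnn : GraphOfGroups.{0, 0, u, u} Unit Unit where
  src _ := ()
  tgt _ := ()
  vertexGroup _ := G
  edgeGroup _ := A
  srcHom _ := A.subtype
  tgtHom _ := B.subtype.comp φ.toMonoidHom
  srcHom_injective _ := A.subtype_injective
  tgtHom_injective _ := B.subtype_injective.comp φ.injective

/-- The single vertex is a spanning tree, so the letter of the loop survives as the stable letter.
-/
theorem isSpanningTree_hnn : (hnn φ).IsSpanningTree ∅ :=
  ⟨fun _ h => h.elim, Set.injOn_empty _, SimpleGraph.IsTree.of_subsingleton⟩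

/-- The fundamental group of the graph of groups of an HNN extension. -/
def hnnEquiv : HNNExtension G A B φ ≃* (hnn φ).FundamentalGroup ∅ := by
  let F : HNNExtension G A B φ →* (hnn φ).FundamentalGroup ∅ :=
    HNNExtension.lift (FundamentalGroup.incl (hnn φ) ∅ ()) (FundamentalGroup.stable (hnn φ) ∅ ())
      (fun a => FundamentalGroup.stable_mul (hnn φ) ∅ () a)
  have hF : ∀ g : G, F (HNNExtension.of g) = FundamentalGroup.incl (hnn φ) ∅ () g :=
    fun g => HNNExtension.lift_of _ _ _ g
  have ht : F HNNExtension.t = FundamentalGroup.stable (hnn φ) ∅ () :=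
    HNNExtension.lift_t _ _ _
  let F' : (hnn φ).FundamentalGroup ∅ →* HNNExtension G A B φ :=
    FundamentalGroup.lift (hnn φ) (fun _ => HNNExtension.of) (fun _ => HNNExtension.t)
      (fun _ a => HNNExtension.t_mul_of a) (fun _ h => h.elim)
  have hF' : ∀ g : G, F' (FundamentalGroup.incl (hnn φ) ∅ () g) = HNNExtension.of g :=
    fun g => FundamentalGroup.lift_incl (hnn φ) _ _ _ _ () g
  have ht' : F' (FundamentalGroup.stable (hnn φ) ∅ ()) = HNNExtension.t :=
    FundamentalGroup.lift_stable (hnn φ) _ _ _ _ ()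
  refine MonoidHom.toMulEquiv F F' ?_ ?_
  · exact HNNExtension.hom_ext
      (MonoidHom.ext fun g => (congrArg F' (hF g)).trans (hF' g)) ((congrArg F' ht).trans ht')
  · exact FundamentalGroup.hom_ext _ (fun _ g => (congrArg F (hF' g)).trans (hF g))
      fun _ => (congrArg F ht').trans ht

end HNN

end GraphOfGroups

/-! ### The main theorem -/

theorem mainTheorem12 :
    -- finite graphs of groups with finite edge groups
    (∀ (V : Type u) (E : Type v) [Finite V] [Finite E] (𝒢 : GraphOfGroups.{u, v, w, x} V E)
        (_ : ∀ e, Finite (𝒢.edgeGroup e)) (T : Set E) (_ : 𝒢.IsSpanningTree T),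
      ((∀ a, ShortcutGraph.IsShortcutGroup (𝒢.vertexGroup a)) →
        ShortcutGraph.IsShortcutGroup (𝒢.FundamentalGroup T)) ∧
      ((∀ a, ShortcutGraph.IsStronglyShortcutGroup (𝒢.vertexGroup a)) →
        ShortcutGraph.IsStronglyShortcutGroup (𝒢.FundamentalGroup T))) ∧
    -- amalgamated products of two groups over a finite subgroup
    (∀ (G : Fin 2 → Type u) [∀ i, Group (G i)] (C : Type v) [Group C] [Finite C]
        (φ : ∀ i, C →* G i) (_ : ∀ i, Function.Injective (φ i)),
      ((∀ i, ShortcutGraph.IsShortcutGroup (G i)) →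
        ShortcutGraph.IsShortcutGroup (Monoid.PushoutI φ)) ∧
      ((∀ i, ShortcutGraph.IsStronglyShortcutGroup (G i)) →
        ShortcutGraph.IsStronglyShortcutGroup (Monoid.PushoutI φ))) ∧
    -- HNN extensions over a finite subgroup
    (∀ (G : Type u) [Group G] (A B : Subgroup G) [Finite A] (φ : A ≃* B),
      (ShortcutGraph.IsShortcutGroup G →
        ShortcutGraph.IsShortcutGroup (HNNExtension G A B φ)) ∧
      (ShortcutGraph.IsStronglyShortcutGroup G →
        ShortcutGraph.IsStronglyShortcutGroup (HNNExtension G A B φ))) := by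
  refine ⟨?_, ?_, ?_⟩
  · intro V E _ _ 𝒢 hfin T hT
    exact ⟨ShortcutGraph.isShortcutGroup_fundamentalGroup 𝒢 hfin hT,
      ShortcutGraph.isStronglyShortcutGroup_fundamentalGroup 𝒢 hfin hT⟩
  · intro G _ C _ _ φ hφ
    have hT := GraphOfGroups.isSpanningTree_amalgam φ hφ
    have hfin : ∀ e, Finite ((GraphOfGroups.amalgam φ hφ).edgeGroup e) :=
      fun _ => inferInstanceAs (Finite C)
    exact ⟨fun h => .of_mulEquiv (GraphOfGroups.amalgamEquiv φ hφ)
        (ShortcutGraph.isShortcutGroup_fundamentalGroup _ hfin hT h),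
      fun h => .of_mulEquiv (GraphOfGroups.amalgamEquiv φ hφ)
        (ShortcutGraph.isStronglyShortcutGroup_fundamentalGroup _ hfin hT h)⟩
  · intro G _ A B _ φ
    have hT := GraphOfGroups.isSpanningTree_hnn φ
    have hfin : ∀ e, Finite ((GraphOfGroups.hnn φ).edgeGroup e) :=
      fun _ => inferInstanceAs (Finite A)
    exact ⟨fun h => .of_mulEquiv (GraphOfGroups.hnnEquiv φ)
        (ShortcutGraph.isShortcutGroup_fundamentalGroup _ hfin hT fun _ => h),
      fun h => .of_mulEquiv (GraphOfGroups.hnnEquiv φ)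
        (ShortcutGraph.isStronglyShortcutGroup_fundamentalGroup _ hfin hT fun _ => h)⟩
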